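/- Let $M$ be an $\aleph_0$-saturated first-order structure in an arbitrary language (for instance, a monster model of a stable theory). Algebraic closure $\mathrm{acl}$, types and Morley rank $RM$ are taken in $M$, over $\emptyset$ unless said otherwise; the rank of a tuple is the rank of its type. A *3-indiscernible array* is a family $F=(f_{i,j,k})_{i,j,k\in\mathbb N}$ of tuples of a fixed finite length with $RM(f_{i,j,k})=1$ such that, for all $n$ and all $i_1<\dots<i_n$, $j_1<\dots<j_n$, $k_1<\dots<k_n$, the families $(f_{i_r,j_s,k_t})_{1\le r,s,t\le n}$ and $(f_{r,s,t})_{1\le r,s,t\le n}$ have the same type over $\emptyset$. Its rank function is $\alpha_F(m,n,p)=RM\big((f_{i,j,k})_{1\le i\le m,\,1\le j\le n,\,1\le k\le p}\big)$. For a parameter set $C\subseteq M$, $F$ has the *group form over $C$* if there are a $C$-definable group $G$ of Morley rank $1$ and $a_i,b_j,c_k\in G$ with $\mathrm{acl}(C,f_{i,j,k})=\mathrm{acl}(C,a_i\cdot b_j\cdot c_k)$ for all $i,j,k$; it has the *field form over $C$* if there are a $C$-definable field, elements $x^1_i,x^2_j,x^3_k$ of it and a permutation $\sigma\in S_3$ with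 $\mathrm{acl}(C,f_{i_1,i_2,i_3})=\mathrm{acl}\big(C,x^{\sigma(1)}_{i_{\sigma(1)}}\cdot(x^{\sigma(2)}_{i_{\sigma(2)}}+x^{\sigma(3)}_{i_{\sigma(3)}})\big)$ for all $i_1,i_2,i_3$. For $C=\emptyset$ one simply says group form and field form. For each of the three directions, the corresponding *frame* of the unit cube $\{f_{i,j,k}: 1\le i,j,k\le 2\}$ is the set of the four pairs (lines) of entries of the cube whose indices differ exactly in that direction, and its *base* $\mathcal C$ is the intersection of the algebraic closures of these four pairs; $RM(\mathcal C)=\max\{RM(g): g\in\mathrm{acl}(\mathcal C)\}$. Let $\mathbb F$ be an algebraically closed field of Morley rank $1$ that is $\emptyset$-definable in $M$, and let $(a^1_i)_{i\in\mathbb N},(a^2_j)_{j\in\mathbb N},(a^3_k)_{k\in\mathbb N}$ be a family of elements of $\mathbb F$ that is algebraically independent in the sense of $\mathrm{acl}$ (no member lies in the algebraic closure of the others). Put $$f_{i,j,k}=\frac{a^1_i+a^2_j}{a^3_k+a^2_j}.$$ Then: 1. $F=(f_{i,j,k})$ is a 3-indiscernible array; 2. $\alpha_F(m,n,p)=m+n+p-2$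 for all $m,n,p\ge 1$; 3. each of the three frames of the unit cube of $F$ has base of Morley rank $0$; 4. $F$ has neither the group form nor the field form; more generally, for every $C\subseteq M$ and $N\in\mathbb N$ such that the family of all $a^1_i,a^2_j,a^3_k$ with $i,j,k>N$ is algebraically independent over $C$, $F$ has neither the group form over $C$ nor the field form over $C$. Consequently the question of Hrushovski and Zilber, whether every 3-indiscernible array with rank function $m+n+p-2$ has the group form or the field form, has a negative answer in $M$. -/

import Mathlib

universe u v w

namespace IndiscernibleArrays

section Basic

variable (L : FirstOrder.Language.{u, v}) {M : Type w} [L.Structure M]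

/-- `ℵ₀`-saturation of `M`: for every finite `A ⊆ M`, each family of `A`-definable subsets of `M`
with the finite intersection property has a common point, i.e. all `1`-types over `A` are realized.
Every monster model has this property. -/
def OmegaSaturated (M : Type w) [L.Structure M] : Prop :=
  ∀ A : Set M, A.Finite → ∀ S : Set (Set M), (∀ s ∈ S, A.Definable₁ L s) →
    (∀ T ⊆ S, T.Finite → (⋂₀ T).Nonempty) → (⋂₀ S).Nonempty

/-- The model-theoretic algebraic closure `acl(B)`: the union of all finite `B`-definable sets. -/
def acl (B : Set M) : Set M :=
  {x | ∃ s : Set M, B.Definable₁ L s ∧ s.Finite ∧ x ∈ s}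

/-- `RM(X) ≥ α` for a set `X` definable with parameters in an `ℵ₀`-saturated structure:
`X` is nonempty and, for every `β < α`, there are infinitely many pairwise disjoint definable
(with parameters) subsets of `X`, all of Morley rank at least `β`. -/
def MorleyRankGE {ι : Type*} (α : Ordinal.{0}) (X : Set (ι → M)) : Prop :=
  X.Nonempty ∧ ∀ β : Ordinal.{0}, ∀ _h : β < α, ∃ Y : ℕ → Set (ι → M),
    (∀ n, Y n ⊆ X ∧ (Set.univ : Set M).Definable L (Y n)) ∧
    Pairwise (fun n m => Disjoint (Y n) (Y m)) ∧
    ∀ n, MorleyRankGE β (Y n)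
termination_by α
decreasing_by exact _h

/-- The definable set `X` has Morley rank exactly `α`. -/
def HasMorleyRank {ι : Type*} (X : Set (ι → M)) (α : Ordinal.{0}) : Prop :=
  MorleyRankGE L α X ∧ ¬ MorleyRankGE L (Order.succ α) X

/-- `RM(x) = α`, where `RM(x)` is the Morley rank of the type of the tuple `x` over `∅`: the least
Morley rank of a `∅`-definable set that contains `x`. -/
def HasTupleRank {ι : Type*} (x : ι → M) (α : Ordinal.{0}) : Prop :=
  (∃ X : Set (ι → M), (∅ : Set M).Definable L X ∧ x ∈ X ∧ HasMorleyRank L X α) ∧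
    ∀ X : Set (ι → M), (∅ : Set M).Definable L X → x ∈ X → MorleyRankGE L α X

/-- The tuples `x` and `y` have the same type over `∅`. -/
def SameType {ι : Type*} (x y : ι → M) : Prop :=
  ∀ φ : L.Formula ι, φ.Realize x ↔ φ.Realize y

/-- A family of tuples is (model-theoretically) algebraically independent over `C`: no member lies
in the algebraic closure of `C` and the other members. -/
def AlgIndepOver {ι : Type*} {d : ℕ} (C : Set M) (x : ι → Fin d → M) : Prop :=
  ∀ i, ¬ Set.range (x i) ⊆ acl L (C ∪ ⋃ j ∈ {j | j ≠ i}, Set.range (x j))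

end Basic

section Arrays

variable (L : FirstOrder.Language.{u, v}) {M : Type w} [L.Structure M] {d : ℕ}

/-- The finite block `(f_i | i_t < m_t for all t)` of an array, as one tuple of elements of `M`. -/
def block {n : ℕ} (f : (Fin n → ℕ) → Fin d → M) (m : Fin n → ℕ) :
    ((∀ t, Fin (m t)) × Fin d) → M :=
  fun p => f (fun t => (p.1 t : ℕ)) p.2

/-- `n`-indiscernible arrays (of elements of `M^d`): all entries have Morley rank `1`, and for all
increasing sequences `j^t_0 < ⋯ < j^t_{m-1}` (`t < n`) the subarray on these indices has the same
type as the initial block of side `m`. -/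
def IsIndiscernibleArray {n : ℕ} (f : (Fin n → ℕ) → Fin d → M) : Prop :=
  (∀ i, HasTupleRank L (f i) 1) ∧
  ∀ (m : ℕ) (j : Fin n → Fin m → ℕ), (∀ t, StrictMono (j t)) →
    SameType L
      (fun p : (Fin n → Fin m) × Fin d => f (fun t => j t (p.1 t)) p.2)
      (fun p : (Fin n → Fin m) × Fin d => f (fun t => (p.1 t : ℕ)) p.2)

/-- The rank function of a `3`-dimensional array is `α(m₀, m₁, m₂) = m₀ + m₁ + m₂ - 2`. -/
def HasRankSumSubTwo (f : (Fin 3 → ℕ) → Fin d → M) : Prop :=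
  ∀ m : Fin 3 → ℕ, (∀ t, 1 ≤ m t) →
    HasTupleRank L (block f m) ((m 0 + m 1 + m 2 - 2 : ℕ) : Ordinal.{0})

/-- The base of the frame of the unit cube consisting of the four lines in direction `t`:
the intersection of the algebraic closures of these lines. (The frames `ℐ₁`, `ℐ₂`, `ℐ₃` of the
unit cube are the ones in the directions of the third, second and first index.) -/
def frameBase (f : (Fin 3 → ℕ) → Fin d → M) (t : Fin 3) : Set M :=
  ⋂ i ∈ {i : Fin 3 → ℕ | ∀ s, i s < 2},
    acl L (Set.range (f (Function.update i t 0)) ∪ Set.range (f (Function.update i t 1)))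

/-- `max {RM(g) | g ∈ acl(C)} = α`. -/
def HasMaxRank (C : Set M) (α : Ordinal.{0}) : Prop :=
  (∃ g ∈ acl L C, HasTupleRank L (fun _ : Fin 1 => g) α) ∧
    ∀ g ∈ acl L C, ∃ β ≤ α, HasTupleRank L (fun _ : Fin 1 => g) β

end Arrays

section Forms

/-- A group definable over `C`, with universe contained in `M^e`. -/
structure DefinableGroup (L : FirstOrder.Language.{u, v}) {M : Type w} [L.Structure M] (C : Set M)
    (e : ℕ) where
  carrier : Set (Fin e → M)
  group : Group carrier
  definable_carrier : C.Definable L carrier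
  definable_mul : C.Definable L {p : Fin 3 × Fin e → M | ∃ x y : carrier,
    (fun s => p (0, s)) = (x : Fin e → M) ∧ (fun s => p (1, s)) = (y : Fin e → M) ∧
    (fun s => p (2, s)) = ((x * y : carrier) : Fin e → M)}

/-- A field definable over `C`, with universe contained in `M^e`. -/
structure DefinableField (L : FirstOrder.Language.{u, v}) {M : Type w} [L.Structure M] (C : Set M)
    (e : ℕ) where
  carrier : Set (Fin e → M)
  field : Field carrier
  definable_carrier : C.Definable L carrier
  definable_add : C.Definable L {p : Fin 3 × Fin e → M | ∃ x y : carrier,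
    (fun s => p (0, s)) = (x : Fin e → M) ∧ (fun s => p (1, s)) = (y : Fin e → M) ∧
    (fun s => p (2, s)) = ((x + y : carrier) : Fin e → M)}
  definable_mul : C.Definable L {p : Fin 3 × Fin e → M | ∃ x y : carrier,
    (fun s => p (0, s)) = (x : Fin e → M) ∧ (fun s => p (1, s)) = (y : Fin e → M) ∧
    (fun s => p (2, s)) = ((x * y : carrier) : Fin e → M)}

variable (L : FirstOrder.Language.{u, v}) {M : Type w} [L.Structure M]

instance (C : Set M) (e : ℕ) (G : DefinableGroup L C e) : Group G.carrier := G.group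

noncomputable instance (C : Set M) (e : ℕ) (K : DefinableField L C e) : Field K.carrier := K.field

/-- `x` and `y` are interalgebraic over `C`: `acl(C, x) = acl(C, y)`. -/
def InteralgOver (C : Set M) {d e : ℕ} (x : Fin d → M) (y : Fin e → M) : Prop :=
  acl L (C ∪ Set.range x) = acl L (C ∪ Set.range y)

/-- The group form over `C`: up to interalgebraicity over `C`, the array is `a_i · b_j · c_k` in a
one-dimensional (Morley rank `1`) group definable over `C`. The plain group form is `C = ∅`. -/
def HasGroupForm (C : Set M) {d : ℕ} (f : (Fin 3 → ℕ) → Fin d → M) : Prop :=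
  ∃ (e : ℕ) (G : DefinableGroup L C e) (a b c : ℕ → G.carrier), HasMorleyRank L G.carrier 1 ∧
    ∀ i : Fin 3 → ℕ, InteralgOver L C (f i) (a (i 0) * b (i 1) * c (i 2) : G.carrier).1

/-- The field form over `C`: up to interalgebraicity over `C`, the array is
`a^{σ(0)} · (a^{σ(1)} + a^{σ(2)})` in a field definable over `C`, where `σ` is a permutation of the
three directions. The plain field form is `C = ∅`. -/
def HasFieldForm (C : Set M) {d : ℕ} (f : (Fin 3 → ℕ) → Fin d → M) : Prop :=
  ∃ (e : ℕ) (K : DefinableField L C e) (a : Fin 3 → ℕ → K.carrier) (σ : Equiv.Perm (Fin 3)),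
    ∀ i : Fin 3 → ℕ, InteralgOver L C (f i)
      (a (σ 0) (i (σ 0)) * (a (σ 1) (i (σ 1)) + a (σ 2) (i (σ 2))) : K.carrier).1

/-- The positive answer, in `M`, to the question of Hrushovski and Zilber: every `3`-indiscernible
array with rank function `m + n + k - 2` has the group form or the field form. -/
def HrushovskiZilberPositive (M : Type w) [L.Structure M] : Prop :=
  ∀ (d : ℕ) (f : (Fin 3 → ℕ) → Fin d → M), IsIndiscernibleArray L f → HasRankSumSubTwo L f →
    HasGroupForm L ∅ f ∨ HasFieldForm L ∅ f

/-- The array `f_{i,j,k} = (a^1_i + a^2_j) / (a^3_k + a^2_j)` in a definable field. -/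
noncomputable def twistedArray {C : Set M} {d : ℕ} (K : DefinableField L C d)
    (a : Fin 3 → ℕ → K.carrier) : (Fin 3 → ℕ) → Fin d → M :=
  fun i => ((a 0 (i 0) + a 1 (i 1)) / (a 2 (i 2) + a 1 (i 1)) : K.carrier).1

end Forms

end IndiscernibleArrays

/-!
The field `K` is strongly minimal, and everything is computed with the quantifier “for all but
finitely many elements of `K`”, written `∀ᶠ x in cofinite`.

*Strong minimality.* Since `RM(K) = 1`, there is an infinite definable `X ⊆ K` which no definable set
splits into two infinite parts (`NoInfiniteSplitting.exists_minimal`). Only finitely many affine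
images of `X` are distinct modulo finite sets, and so some nonzero translation fixes all of them
modulo finite sets; conjugating by dilations, every translation fixes `X` modulo a finite set
(`exists_minimal_translation_invariant`). If the complement of `X` were infinite, then adding
elements of `X` to elements of the complement would contradict the uniform finiteness that comes
from saturation (`stronglyMinimal_of_noInfiniteSplitting`).

*Generic tuples.* By strong minimality the quantifier “for all but finitely many” commutes with
negation, preserves definability and commutes with itself. Iterated, it gives a filter `generic` of
large sets of `n`-tuples, and an algebraically independent tuple lies in an `A`-definable set if and
only if that set is large (`AlgIndepOver.iff_eventually_generic`). This yields indiscernibility.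

*Morley rank.* An injective definable image of a large set of `n`-tuples has rank at least `n`
(`StronglyMinimal.morleyRankGE_image`), and a definable image of `Kⁿ` has rank at most `n`
(`StronglyMinimal.not_morleyRankGE_range`). The array is invariant under the affine transformations
`a ↦ (a + b₀) / s`, `b ↦ (b - b₀) / s`, `c ↦ (c + b₀) / s`, so that one may put `b₀ = 0` and `c₀ = 1`;
the remaining `m + n + p - 2` parameters of a block are determined by its entries.

*Bases and forms.* For each direction, two opposite lines of the unit cube together form a generic
quadruple (`lines_generic`, by a triangular change of variables), and an element algebraic over both
of them is therefore algebraic (`StronglyMinimal.mem_acl_of_generic_pairs`). So the bases have rank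
`0`. On the other hand, in the group form `c₀⁻¹ c₁`, and in the field form `x₁ / x₀` for the
multiplicative parameter `x`, is algebraic over every line in one direction; if it were algebraic over
the base set, the two entries of a line would be interalgebraic (`no_common_quotient`).
-/

namespace IndiscernibleArrays

open Set FirstOrder FirstOrder.Language Function Filter

/-! ### Definable sorts, predicates and maps -/

/-- A definable sort of the structure `M`: a type `E` with an injective coding of its elements by
finite tuples of elements of `M`, whose set of codes is `∅`-definable. -/
class DSort (L : FirstOrder.Language.{u, v}) (M : Type w) [L.Structure M] (E : Type w) where
  /-- The coordinates of a code. -/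
  coord : Type
  finite_coord : Finite coord
  /-- The coding map. -/
  code : E → coord → M
  code_injective : Injective code
  definable_range : (∅ : Set M).Definable L (range code)

attribute [instance] DSort.finite_coord

section Calculus

variable (L : FirstOrder.Language.{u, v}) {M : Type w} [L.Structure M]

/-- The code of an element of a definable sort, as a tuple of elements of `M`. -/
abbrev code (M : Type w) [L.Structure M] {E : Type w} [DSort L M E] (x : E) :
    DSort.coord L M E → M := DSort.code x

/-- The predicate `P` on a definable sort is definable with parameters from `A`. -/
def DefP (A : Set M) {E : Type w} [DSort L M E] (P : E → Prop) : Prop :=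
  A.Definable L (code L M '' {x | P x})

/-- The map `f` between definable sorts has a graph definable with parameters from `A`. The graph
is read off from codes of pairs. -/
def DefF (A : Set M) {E F : Type w} [DSort L M E] [DSort L M F] (f : E → F) : Prop :=
  A.Definable L (range fun x => Sum.elim (code L M x) (code L M (f x)))

variable {L} {A B : Set M} {E F G : Type w} [DSort L M E] [DSort L M F] [DSort L M G]

theorem definable_setOf_apply_eq {α : Type*} (i j : α) :
    A.Definable L {v : α → M | v i = v j} :=
  ⟨(Term.var i).equal (Term.var j), by ext; simp⟩

theorem definable_setOf_comp_eq {α β : Type*} [Finite β] (σ τ : β → α) :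
    A.Definable L {v : α → M | v ∘ σ = v ∘ τ} := by
  have : {v : α → M | v ∘ σ = v ∘ τ} = ⋂ b, {v : α → M | v (σ b) = v (τ b)} := by
    ext v; simp [funext_iff]
  rw [this]
  exact definable_iInter_of_finite fun b => definable_setOf_apply_eq _ _

theorem definable_setOf_eq {α : Type*} [Finite α] (c : α → M) (hc : range c ⊆ A) :
    A.Definable L {v : α → M | v = c} := by
  have : {v : α → M | v = c} = ⋂ b, {v : α → M | v b = c b} := by
    ext v; simp [funext_iff]
  rw [this]
  refine definable_iInter_of_finite fun b => ?_
  have h := (Definable.singleton_of_mem L (hc ⟨b, rfl⟩)).preimage_comp (fun _ : Fin 1 => b)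
  exact h

instance : DSort L M M where
  coord := Fin 1
  finite_coord := inferInstance
  code x := fun _ => x
  code_injective x y h := congrFun h 0
  definable_range := by
    convert definable_univ
    rw [eq_univ_iff_forall]
    intro v
    exact ⟨v 0, by ext i; rw [Subsingleton.elim i 0]⟩

instance : DSort L M (E × F) where
  coord := DSort.coord L M E ⊕ DSort.coord L M F
  finite_coord := inferInstance
  code x := Sum.elim (code L M x.1) (code L M x.2)
  code_injective x y h := by
    refine Prod.ext (DSort.code_injective (L := L) (M := M) ?_)
      (DSort.code_injective (L := L) (M := M) ?_)
    · exact funext fun k => congrFun h (Sum.inl k)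
    · exact funext fun k => congrFun h (Sum.inr k)
  definable_range := by
    have h1 := (DSort.definable_range (L := L) (M := M) (E := E)).preimage_comp
      (Sum.inl : _ → DSort.coord L M E ⊕ DSort.coord L M F)
    have h2 := (DSort.definable_range (L := L) (M := M) (E := F)).preimage_comp
      (Sum.inr : _ → DSort.coord L M E ⊕ DSort.coord L M F)
    convert h1.inter h2 using 1
    ext v
    constructor
    · rintro ⟨x, rfl⟩
      exact ⟨⟨x.1, by ext; rfl⟩, ⟨x.2, by ext; rfl⟩⟩
    · rintro ⟨⟨x, hx⟩, ⟨y, hy⟩⟩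
      refine ⟨(x, y), ?_⟩
      ext k
      rcases k with k | k
      · exact congrFun hx k
      · exact congrFun hy k

instance {ι : Type} [Finite ι] : DSort L M (ι → E) where
  coord := ι × DSort.coord L M E
  finite_coord := inferInstance
  code x := fun p => code L M (x p.1) p.2
  code_injective x y h := by
    refine funext fun i => DSort.code_injective (L := L) (M := M) ?_
    exact funext fun k => congrFun h (i, k)
  definable_range := by
    have h : ∀ i : ι, (∅ : Set M).Definable L
        {v : ι × DSort.coord L M E → M | (fun k => v (i, k)) ∈ range (code L M (E := E))} :=
      fun i => (DSort.definable_range (L := L) (M := M) (E := E)).preimage_comp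
        (fun k => (i, k))
    convert definable_iInter_of_finite h using 1
    ext v
    simp only [mem_iInter]
    constructor
    · rintro ⟨x, rfl⟩ i
      exact ⟨x i, rfl⟩
    · intro hv
      choose x hx using hv
      exact ⟨x, funext fun p => congrFun (hx p.1) p.2⟩

instance {d : ℕ} (K : DefinableField L (∅ : Set M) d) : DSort L M K.carrier where
  coord := Fin d
  finite_coord := inferInstance
  code x := x.1
  code_injective := Subtype.val_injective
  definable_range := by
    rw [Subtype.range_coe]
    exact K.definable_carrier

theorem code_inj {x y : E} : code L M x = code L M y ↔ x = y :=
  (DSort.code_injective (L := L) (M := M)).eq_iff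

theorem mem_code_image {P : E → Prop} {x : E} : code L M x ∈ code L M '' {x | P x} ↔ P x :=
  (DSort.code_injective (L := L) (M := M)).mem_set_image

theorem DefP.mono {P : E → Prop} (h : DefP L A P) (hAB : A ⊆ B) : DefP L B P :=
  Definable.mono h hAB

theorem DefP.congr {P Q : E → Prop} (h : DefP L A P) (hPQ : ∀ x, P x ↔ Q x) : DefP L A Q := by
  rwa [show Q = P from funext fun x => propext (hPQ x).symm]

theorem definable_range_code : A.Definable L (range (code L M (E := E))) :=
  (DSort.definable_range (L := L) (M := M) (E := E)).mono (empty_subset _)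

/-- A definable set of tuples pulls back to a definable predicate along the coding. -/
theorem Definable.defP {S : Set (DSort.coord L M E → M)} (hS : A.Definable L S) :
    DefP L A (fun x : E => code L M x ∈ S) := by
  refine Eq.mp (congrArg (A.Definable L) ?_) (definable_range_code.inter hS)
  ext v
  constructor
  · rintro ⟨⟨x, rfl⟩, h⟩; exact ⟨x, h, rfl⟩
  · rintro ⟨x, h, rfl⟩; exact ⟨⟨x, rfl⟩, h⟩

theorem DefP.and {P Q : E → Prop} (hP : DefP L A P) (hQ : DefP L A Q) :
    DefP L A fun x => P x ∧ Q x :=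
  (Definable.defP (E := E) (Definable.inter hP hQ)).congr fun x => by
    simp only [mem_inter_iff, mem_code_image]

theorem DefP.or {P Q : E → Prop} (hP : DefP L A P) (hQ : DefP L A Q) :
    DefP L A fun x => P x ∨ Q x :=
  (Definable.defP (E := E) (Definable.union hP hQ)).congr fun x => by
    simp only [mem_union, mem_code_image]

theorem DefP.not {P : E → Prop} (hP : DefP L A P) : DefP L A fun x => ¬ P x :=
  (Definable.defP (E := E) (Definable.compl hP)).congr fun x => by
    simp only [mem_compl_iff, mem_code_image]

theorem DefP.imp {P Q : E → Prop} (hP : DefP L A P) (hQ : DefP L A Q) :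
    DefP L A fun x => P x → Q x :=
  (hP.not.or hQ).congr fun _ => imp_iff_not_or.symm

theorem DefP.true : DefP L A fun _ : E => True :=
  (Definable.defP (E := E) definable_univ).congr fun x => by simp

theorem DefP.forall_finite {ι : Type*} [Finite ι] {P : ι → E → Prop} (h : ∀ i, DefP L A (P i)) :
    DefP L A fun x => ∀ i, P i x :=
  (Definable.defP (E := E) (definable_iInter_of_finite h)).congr fun x => by
    simp only [mem_iInter, mem_code_image]

theorem DefP.ex {P : E → F → Prop} (h : DefP L A fun p : E × F => P p.1 p.2) :
    DefP L A fun x => ∃ y, P x y := by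
  refine (Definable.defP (E := E) (Definable.image_comp h Sum.inl)).congr fun x => ?_
  constructor
  · rintro ⟨_, ⟨⟨x', y⟩, hp, rfl⟩, hx⟩
    have : x' = x := DSort.code_injective (L := L) (M := M) hx
    exact ⟨y, this ▸ hp⟩
  · rintro ⟨y, hy⟩
    exact ⟨_, ⟨(x, y), hy, rfl⟩, rfl⟩

theorem DefP.all {P : E → F → Prop} (h : DefP L A fun p : E × F => P p.1 p.2) :
    DefP L A fun x => ∀ y, P x y :=
  (DefP.ex (P := fun x y => ¬ P x y) h.not).not.congr fun x => by simp

/-- A definable predicate pulls back along a map that only selects coordinates. -/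
theorem DefP.reindex {P : F → Prop} (hP : DefP L A P) (h : E → F)
    (σ : DSort.coord L M F → DSort.coord L M E) (hσ : ∀ x, code L M (h x) = code L M x ∘ σ) :
    DefP L A fun x => P (h x) :=
  (Definable.defP (E := E) (Definable.preimage_comp σ hP)).congr fun x => by
    rw [mem_preimage, ← hσ, mem_code_image]

theorem DefF.graph {f : E → F} : DefF L A f ↔ DefP L A fun p : E × F => f p.1 = p.2 := by
  refine iff_of_eq (congrArg (A.Definable L) ?_)
  ext v
  constructor
  · rintro ⟨x, rfl⟩; exact ⟨(x, f x), rfl, rfl⟩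
  · rintro ⟨⟨x, y⟩, h, rfl⟩
    exact ⟨x, by rw [show y = f x from h.symm]; rfl⟩

theorem DefF.mono {f : E → F} (h : DefF L A f) (hAB : A ⊆ B) : DefF L B f :=
  Definable.mono h hAB

theorem DefP.eq_pair : DefP L A fun p : E × E => p.1 = p.2 :=
  (Definable.defP (E := E × E) (definable_setOf_comp_eq (Sum.inl : DSort.coord L M E → _)
    Sum.inr)).congr fun _ => code_inj

theorem DefF.of_reindex (h : E → F)
    (σ : DSort.coord L M F → DSort.coord L M E) (hσ : ∀ x, code L M (h x) = code L M x ∘ σ) :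
    DefF L A h :=
  DefF.graph.2 <| DefP.reindex (DefP.eq_pair (E := F)) (fun p : E × F => (h p.1, p.2))
    (Sum.map σ id) fun p => by
      ext k
      rcases k with k | k
      · exact congrFun (hσ p.1) k
      · rfl

theorem DefF.id : DefF L A fun x : E => x :=
  .of_reindex _ (fun k => k) fun _ => rfl

theorem DefP.comp {P : F → Prop} {f : E → F} (hP : DefP L A P) (hf : DefF L A f) :
    DefP L A fun x => P (f x) :=
  (DefP.ex (P := fun x y => f x = y ∧ P y) ((DefF.graph.1 hf).and
    (hP.reindex (fun p : E × F => p.2) Sum.inr fun _ => rfl))).congr fun x => by simp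

theorem DefF.comp {g : F → G} {f : E → F} (hg : DefF L A g) (hf : DefF L A f) :
    DefF L A fun x => g (f x) := by
  refine DefF.graph.2 ((DefP.ex (E := E × G) (P := fun p y => f p.1 = y ∧ g y = p.2)
    (DefP.and ?_ ?_)).congr fun x => by simp)
  · exact (DefF.graph.1 hf).reindex (fun p : (E × G) × F => (p.1.1, p.2))
      (Sum.map Sum.inl (fun k => k)) fun p => by ext (k | k) <;> rfl
  · exact (DefF.graph.1 hg).reindex (fun p : (E × G) × F => (p.2, p.1.2))
      (Sum.elim Sum.inr (Sum.inl ∘ Sum.inr)) fun p => by ext (k | k) <;> rfl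

theorem DefF.fst {f : E → F × G} (hf : DefF L A f) : DefF L A fun x => (f x).1 :=
  DefF.comp (DefF.of_reindex Prod.fst Sum.inl fun _ => rfl) hf

theorem DefF.snd {f : E → F × G} (hf : DefF L A f) : DefF L A fun x => (f x).2 :=
  DefF.comp (DefF.of_reindex Prod.snd Sum.inr fun _ => rfl) hf

theorem DefF.prodMk {f : E → F} {g : E → G} (hf : DefF L A f) (hg : DefF L A g) :
    DefF L A fun x => (f x, g x) := by
  refine DefF.graph.2 ((DefP.and (P := fun p : E × (F × G) => f p.1 = p.2.1)
    (Q := fun p => g p.1 = p.2.2) ?_ ?_).congr fun x => by simp [Prod.ext_iff])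
  · exact (DefF.graph.1 hf).reindex (fun p : E × (F × G) => (p.1, p.2.1))
      (Sum.map (fun k => k) Sum.inl) fun p => by ext (k | k) <;> rfl
  · exact (DefF.graph.1 hg).reindex (fun p : E × (F × G) => (p.1, p.2.2))
      (Sum.map (fun k => k) Sum.inr) fun p => by ext (k | k) <;> rfl

theorem DefF.apply {ι : Type} [Finite ι] {f : E → ι → F} (hf : DefF L A f) (i : ι) :
    DefF L A fun x => f x i :=
  DefF.comp (g := fun x : ι → F => x i) (DefF.of_reindex _ (fun k => (i, k)) fun _ => rfl) hf

theorem DefF.pi {ι : Type} [Finite ι] {f : E → ι → F} (hf : ∀ i, DefF L A fun x => f x i) :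
    DefF L A f := by
  refine DefF.graph.2 ((DefP.forall_finite (P := fun i (p : E × (ι → F)) => f p.1 i = p.2 i)
    fun i => ?_).congr fun x => by simp [funext_iff])
  exact (DefF.graph.1 (hf i)).reindex (fun p : E × (ι → F) => (p.1, p.2 i))
    (Sum.map (fun k => k) (fun k => (i, k))) fun p => by ext (k | k) <;> rfl

theorem DefF.const (c : F) (hc : range (code L M c) ⊆ A) : DefF L A fun _ : E => c :=
  DefF.graph.2 <| ((Definable.defP (E := F) (definable_setOf_eq (code L M c) hc)).congr
    (Q := fun y => c = y) fun y => by
      rw [mem_ofPred_eq, code_inj]; exact eq_comm).reindex _ Sum.inr fun _ => rfl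

/-- The coordinates of a code are definable functions. -/
theorem DefF.code_apply {f : E → F} (hf : DefF L A f) (k : DSort.coord L M F) :
    DefF L A fun x => code L M (f x) k :=
  DefF.comp (g := fun y : F => code L M y k) (DefF.of_reindex _ (fun _ => k) fun _ => rfl) hf

theorem DefP.eq {f g : E → F} (hf : DefF L A f) (hg : DefF L A g) :
    DefP L A fun x => f x = g x :=
  DefP.eq_pair.comp (hf.prodMk hg)

end Calculus

/-! ### Parameters, algebraic closure and saturation -/

section Parameters

variable {L : FirstOrder.Language.{u, v}} {M : Type w} [L.Structure M]
variable {A B : Set M} {E F G : Type w} [DSort L M E] [DSort L M F] [DSort L M G]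

theorem DefF.finCons {n : ℕ} {f : E → F} {g : E → Fin n → F} (hf : DefF L A f)
    (hg : DefF L A g) : DefF L A fun x => (Fin.cons (f x) (g x) : Fin (n + 1) → F) := by
  refine DefF.pi fun i => ?_
  refine Fin.cases ?_ (fun j => ?_) i
  · simpa using hf
  · simpa using hg.apply j

theorem DefF.finSnoc {n : ℕ} {f : E → F} {g : E → Fin n → F} (hg : DefF L A g)
    (hf : DefF L A f) : DefF L A fun x => (Fin.snoc (g x) (f x) : Fin (n + 1) → F) := by
  refine DefF.pi fun i => ?_
  refine Fin.lastCases ?_ (fun j => ?_) i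
  · simpa using hf
  · simpa using hg.apply j

/-- A set definable over `A` and a finite tuple `c` is a fibre over `c` of a set definable
over `A`. -/
theorem exists_definable_family {κ α : Type*} {c : κ → M} {s : Set (α → M)}
    (h : (A ∪ range c).Definable L s) :
    ∃ S : Set (κ ⊕ α → M), A.Definable L S ∧ ∀ v, v ∈ s ↔ Sum.elim c v ∈ S := by
  classical
  obtain ⟨φ, rfl⟩ := definable_iff_exists_formula_sum.1 h
  have hg : ∀ a : ↥(A ∪ range c), ∃ b : A ⊕ κ, Sum.elim (fun a : A => (a : M)) c b = a := by
    rintro ⟨a, ha | ⟨k, rfl⟩⟩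
    · exact ⟨Sum.inl ⟨a, ha⟩, rfl⟩
    · exact ⟨Sum.inr k, rfl⟩
  choose g hg using hg
  refine ⟨_, definable_iff_exists_formula_sum.2 ⟨φ.relabel
    (Sum.elim (fun a => Sum.map id Sum.inl (g a)) fun i => Sum.inr (Sum.inr i)), rfl⟩, fun v => ?_⟩
  simp only [mem_ofPred_eq, Formula.realize_relabel]
  refine iff_of_eq (congrArg _ (funext fun x => ?_))
  rcases x with a | i
  · rw [Sum.elim_inl, ← hg a]
    simp only [comp_apply, Sum.elim_inl]
    rcases g a with b | b <;> rfl
  · rfl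

theorem DefP.exists_family {P : F → Prop} {c : E} (h : DefP L (A ∪ range (code L M c)) P) :
    ∃ S : E × F → Prop, DefP L A S ∧ ∀ y, P y ↔ S (c, y) := by
  obtain ⟨S, hS, h'⟩ := exists_definable_family h
  exact ⟨_, Definable.defP (E := E × F) hS, fun y => (mem_code_image (P := P)).symm.trans (h' _)⟩

/-- Fixing one argument of a definable predicate. -/
theorem DefP.fix {P : E × F → Prop} (h : DefP L A P) (c : E) :
    DefP L (A ∪ range (code L M c)) fun y => P (c, y) :=
  (h.mono subset_union_left).comp ((DefF.const c subset_union_right).prodMk DefF.id)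

theorem DefP.fix_univ {P : E × F → Prop} (h : DefP L (univ : Set M) P) (c : E) :
    DefP L (univ : Set M) fun y => P (c, y) :=
  (h.fix c).mono (subset_univ _)

theorem DefP.exists_finset {P : E → Prop} (h : DefP L A P) :
    ∃ A₀ : Finset M, (A₀ : Set M) ⊆ A ∧ DefP L (A₀ : Set M) P :=
  definable_iff_finitely_definable.1 h

theorem lt_encard_iff_exists_injective {α : Type*} {s : Set α} {N : ℕ} :
    (N : ℕ∞) < s.encard ↔ ∃ f : Fin (N + 1) → α, Injective f ∧ ∀ i, f i ∈ s := by
  constructor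
  · intro h
    obtain ⟨t, hts, ht⟩ := exists_subset_encard_eq (Order.add_one_le_of_lt h)
    have hfin : t.Finite := finite_of_encard_eq_coe (k := N + 1) (by simpa using ht)
    have hcard : t.ncard = N + 1 := by
      rw [ncard, ht]; rfl
    have := hfin.to_subtype
    have e : Fin (N + 1) ≃ t := (finCongr hcard.symm).trans (Finite.equivFin t).symm
    exact ⟨fun i => e i, Subtype.val_injective.comp e.injective, fun i => hts (e i).2⟩
  · rintro ⟨f, hf, hs⟩
    have h1 : (range f).encard = N + 1 := by
      rw [← image_univ, hf.encard_image, encard_univ]; simp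
    calc (N : ℕ∞) < N + 1 := by exact_mod_cast Nat.lt_succ_self N
      _ = (range f).encard := h1.symm
      _ ≤ s.encard := encard_le_encard (range_subset_iff.2 hs)

theorem DefP.lt_encard {P : E × F → Prop} (h : DefP L A P) (N : ℕ) :
    DefP L A fun e => (N : ℕ∞) < {y | P (e, y)}.encard := by
  refine (DefP.ex (F := Fin (N + 1) → F) (P := fun e f => Injective f ∧ ∀ i, P (e, f i))
    (DefP.and ?_ ?_)).congr fun e =>
      (lt_encard_iff_exists_injective (s := {y | P (e, y)})).symm
  · exact DefP.forall_finite fun i => DefP.forall_finite fun j =>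
      (DefP.eq (DefF.id.snd.apply i) (DefF.id.snd.apply j)).imp (by
        by_cases hij : i = j
        · exact DefP.true.congr fun _ => by simp [hij]
        · exact DefP.true.not.congr fun _ => by simp [hij])
  · exact DefP.forall_finite fun i => h.comp (DefF.id.fst.prodMk (DefF.id.snd.apply i))

theorem DefP.encard_le {P : E × F → Prop} (h : DefP L A P) (N : ℕ) :
    DefP L A fun e => {y | P (e, y)}.encard ≤ (N : ℕ∞) :=
  (h.lt_encard N).not.congr fun _ => not_lt

/-! #### Algebraic closure -/

theorem definable₁_iff_defP {s : Set M} : A.Definable₁ L s ↔ DefP L A (· ∈ s) := by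
  refine iff_of_eq (congrArg (A.Definable L) ?_)
  ext v
  constructor
  · intro h
    exact ⟨v 0, h, funext fun i : Fin 1 => by rw [Subsingleton.elim i 0]; rfl⟩
  · rintro ⟨x, hx, rfl⟩
    exact hx

theorem mem_acl_iff {x : M} :
    x ∈ acl L A ↔ ∃ P : M → Prop, DefP L A P ∧ {y | P y}.Finite ∧ P x := by
  constructor
  · rintro ⟨s, hs, hf, hx⟩
    exact ⟨(· ∈ s), definable₁_iff_defP.1 hs, hf, hx⟩
  · rintro ⟨P, hP, hf, hx⟩
    exact ⟨{y | P y}, definable₁_iff_defP.2 hP, hf, hx⟩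

theorem acl_mono (h : A ⊆ B) : acl L A ⊆ acl L B := by
  rintro x ⟨s, hs, hf, hx⟩
  exact ⟨s, Definable.mono hs h, hf, hx⟩

theorem subset_acl : A ⊆ acl L A := fun _ ha =>
  ⟨_, Definable.singleton_of_mem L ha, finite_singleton _, rfl⟩

/-- The coordinates of an element of a finite definable set are algebraic. -/
theorem DefP.range_code_subset_acl {P : E → Prop} (hP : DefP L A P) (hf : {x | P x}.Finite)
    {x : E} (hx : P x) : range (code L M x) ⊆ acl L A := by
  rintro _ ⟨k, rfl⟩
  refine mem_acl_iff.2 ⟨fun m => ∃ y, code L M y k = m ∧ P y, ?_, ?_, x, rfl, hx⟩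
  · exact DefP.ex (P := fun m (y : E) => code L M y k = m ∧ P y)
      ((DefP.eq (DefF.id.snd.code_apply k) DefF.id.fst).and (hP.comp DefF.id.snd))
  · refine (hf.image fun y => code L M y k).subset ?_
    rintro m ⟨y, hy, hPy⟩
    exact ⟨y, hPy, hy⟩

/-- Algebraicity over a finite tuple is witnessed by a uniformly finite definable family. -/
theorem exists_family_of_mem_acl {c : E} {x : M} (h : x ∈ acl L (A ∪ range (code L M c))) :
    ∃ (S : E × M → Prop) (N : ℕ), DefP L A S ∧ S (c, x) ∧
      ∀ e, {y | S (e, y)}.encard ≤ (N : ℕ∞) := by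
  obtain ⟨P, hP, hf, hx⟩ := mem_acl_iff.1 h
  obtain ⟨S, hS, hPS⟩ := hP.exists_family
  have hN : {y | S (c, y)}.encard ≤ (({y | P y}.ncard : ℕ) : ℕ∞) := by
    rw [hf.cast_ncard_eq]
    exact encard_le_encard fun y hy => (hPS y).2 hy
  refine ⟨fun p => S p ∧ {y | S (p.1, y)}.encard ≤ (({y | P y}.ncard : ℕ) : ℕ∞), {y | P y}.ncard,
    hS.and ((hS.encard_le _).comp DefF.id.fst), ⟨(hPS x).1 hx, hN⟩, fun e => ?_⟩
  by_cases he : {y | S (e, y)}.encard ≤ (({y | P y}.ncard : ℕ) : ℕ∞)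
  · exact (encard_le_encard fun y hy => hy.1).trans he
  · simp [he]

/-- If a tuple is algebraic over another one, this is witnessed by a definable family of finite
sets. -/
theorem exists_family_of_range_subset_acl {c : E} {x : F}
    (h : range (code L M x) ⊆ acl L (A ∪ range (code L M c))) :
    ∃ S : E × F → Prop, DefP L A S ∧ S (c, x) ∧ ∀ e, {y | S (e, y)}.Finite := by
  choose S N hS hSx hN using fun k => exists_family_of_mem_acl (h ⟨k, rfl⟩)
  refine ⟨fun p => ∀ k, S k (p.1, code L M p.2 k), DefP.forall_finite fun k =>
    (hS k).comp (DefF.id.fst.prodMk (DefF.id.snd.code_apply k)), hSx, fun e => ?_⟩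
  have : {f : DSort.coord L M F → M | ∀ k, f k ∈ {y | S k (e, y)}}.Finite :=
    Finite.pi' fun k => finite_of_encard_le_coe (hN k e)
  exact Finite.of_finite_image (f := code L M) (this.subset (by
    rintro _ ⟨y, hy, rfl⟩ k
    exact hy k)) (DSort.code_injective (L := L) (M := M)).injOn

theorem acl_subset_of_subset_acl (h : B ⊆ acl L A) : acl L B ⊆ acl L A := by
  intro x hx
  obtain ⟨P, hP, hf, hx⟩ := mem_acl_iff.1 hx
  obtain ⟨B₀, hB₀, hP₀⟩ := hP.exists_finset
  let b : Fin B₀.card → M := fun i => (B₀.equivFin.symm i : M)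
  have hb : range (code L M b) = B₀ := by
    ext m
    constructor
    · rintro ⟨⟨i, _⟩, rfl⟩
      exact (B₀.equivFin.symm i).2
    · intro hm
      exact ⟨(B₀.equivFin ⟨m, hm⟩, (0 : Fin 1)), by simp [b, code, DSort.code]⟩
  have hx' : x ∈ acl L (A ∪ range (code L M b)) :=
    mem_acl_iff.2 ⟨P, hP₀.mono (hb ▸ subset_union_right), hf, hx⟩
  obtain ⟨S, N, hS, hSx, hN⟩ := exists_family_of_mem_acl hx'
  have hbA : ∀ i, b i ∈ acl L A := fun i => h (hB₀ (B₀.equivFin.symm i).2)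
  choose Q hQ hQf hQb using fun i => mem_acl_iff.1 (hbA i)
  refine mem_acl_iff.2 ⟨fun m => ∃ c : Fin B₀.card → M, (∀ i, Q i (c i)) ∧ S (c, m), ?_, ?_,
    b, hQb, hSx⟩
  · exact DefP.ex (P := fun m (c : Fin B₀.card → M) => (∀ i, Q i (c i)) ∧ S (c, m))
      ((DefP.forall_finite fun i => (hQ i).comp (DefF.id.snd.apply i)).and
        (hS.comp (DefF.id.snd.prodMk DefF.id.fst)))
  · have hfin : {c : Fin B₀.card → M | ∀ i, Q i (c i)}.Finite :=
      (Finite.pi' (t := fun i => {m | Q i m}) hQf)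
    refine (hfin.biUnion fun c _ => finite_of_encard_le_coe (hN c)).subset ?_
    rintro m ⟨c, hc, hm⟩
    exact mem_biUnion (x := c) hc hm

/-! #### Saturation -/

/-- In an `ℵ₀`-saturated structure, a decreasing sequence of nonempty sets of tuples, definable
over a common finite set, has a common point. -/
theorem OmegaSaturated.exists_forall_fin (hsat : OmegaSaturated L M) (n : ℕ) :
    ∀ (A : Set M), A.Finite → ∀ S : ℕ → (Fin n → M) → Prop, (∀ i, DefP L A (S i)) →
      (∀ i x, S (i + 1) x → S i x) → (∀ i, ∃ x, S i x) → ∃ x, ∀ i, S i x := by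
  induction n with
  | zero =>
    intro A _ S _ _ hne
    refine ⟨Fin.elim0, fun i => ?_⟩
    obtain ⟨x, hx⟩ := hne i
    rwa [Subsingleton.elim Fin.elim0 x]
  | succ n ih =>
    intro A hA S hS hanti hne
    have hanti' : ∀ i j, i ≤ j → ∀ x, S j x → S i x := by
      intro i j hij
      induction hij with
      | refl => exact fun _ h => h
      | step _ ih => exact fun x hx => ih x (hanti _ x hx)
    have hcons : ∀ i, DefP L A fun p : M × (Fin n → M) => S i (Fin.cons p.1 p.2) := fun i =>
      (hS i).comp (DefF.id.fst.finCons DefF.id.snd)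
    obtain ⟨c, hc⟩ : (⋂₀ range fun i => {m : M | ∃ v : Fin n → M, S i (Fin.cons m v)}).Nonempty := by
      refine hsat A hA _ ?_ ?_
      · rintro _ ⟨i, rfl⟩
        exact definable₁_iff_defP.2 (hcons i).ex
      · intro T hT hTf
        choose! I hI using hT
        obtain ⟨n, hn⟩ := (hTf.image I).bddAbove
        obtain ⟨x, hx⟩ := hne n
        refine ⟨x 0, fun t ht => ?_⟩
        rw [← hI ht]
        exact ⟨Fin.tail x, by rw [Fin.cons_self_tail]; exact hanti' _ _ (hn ⟨t, ht, rfl⟩) x hx⟩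
    have hc' : ∀ i, ∃ v : Fin n → M, S i (Fin.cons c v) := fun i => hc _ ⟨i, rfl⟩
    obtain ⟨x, hx⟩ := ih (A ∪ range (code L M c)) (hA.union (finite_range _))
      (fun i v => S i (Fin.cons c v)) (fun i => (hcons i).fix c) (fun i x => hanti i _) hc'
    exact ⟨Fin.cons c x, hx⟩

theorem OmegaSaturated.exists_forall (hsat : OmegaSaturated L M) (hA : A.Finite)
    {S : ℕ → E → Prop} (hS : ∀ i, DefP L A (S i)) (hanti : ∀ i x, S (i + 1) x → S i x)
    (hne : ∀ i, ∃ x, S i x) : ∃ x, ∀ i, S i x := by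
  let e := Finite.equivFin (DSort.coord L M E)
  let t : E → Fin (Nat.card (DSort.coord L M E)) → M := fun x i => code L M x (e.symm i)
  have ht : Injective t := fun x y h => code_inj.1 <| funext fun k => by
    simpa [t] using congrFun h (e k)
  have htd : DefF L A t := DefF.pi fun i => DefF.id.code_apply (e.symm i)
  obtain ⟨v, hv⟩ := hsat.exists_forall_fin _ A hA (fun i v => ∃ x, t x = v ∧ S i x)
    (fun i => DefP.ex (P := fun v x => t x = v ∧ S i x)
      ((DefP.eq (htd.comp DefF.id.snd) DefF.id.fst).and ((hS i).comp DefF.id.snd)))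
    (fun i v ⟨x, hx, h⟩ => ⟨x, hx, hanti i x h⟩)
    (fun i => let ⟨x, hx⟩ := hne i; ⟨t x, x, rfl, hx⟩)
  obtain ⟨x, hx, -⟩ := hv 0
  refine ⟨x, fun i => ?_⟩
  obtain ⟨y, hy, h⟩ := hv i
  rwa [ht (hx.trans hy.symm)]

/-- Uniform finiteness: in an `ℵ₀`-saturated structure, if for each parameter one of two sets is
finite, then there is a uniform bound. -/
theorem OmegaSaturated.exists_uniform_bound (hsat : OmegaSaturated L M) {P Q : E × F → Prop}
    (hP : DefP L (univ : Set M) P) (hQ : DefP L (univ : Set M) Q)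
    (h : ∀ e, {y | P (e, y)}.Finite ∨ {y | Q (e, y)}.Finite) :
    ∃ N : ℕ, ∀ e, {y | P (e, y)}.encard ≤ (N : ℕ∞) ∨ {y | Q (e, y)}.encard ≤ (N : ℕ∞) := by
  by_contra! hN
  obtain ⟨A₁, -, h₁⟩ := hP.exists_finset
  obtain ⟨A₂, -, h₂⟩ := hQ.exists_finset
  have h₁' := h₁.mono (subset_union_left (t := (A₂ : Set M)))
  have h₂' := h₂.mono (subset_union_right (s := (A₁ : Set M)))
  obtain ⟨e, he⟩ := hsat.exists_forall (A₁.finite_toSet.union A₂.finite_toSet)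
    (S := fun N e => (N : ℕ∞) < {y | P (e, y)}.encard ∧ (N : ℕ∞) < {y | Q (e, y)}.encard)
    (fun N => (h₁'.lt_encard N).and (h₂'.lt_encard N))
    (fun N e h => have hlt : (N : ℕ∞) < ((N + 1 : ℕ) : ℕ∞) := by exact_mod_cast Nat.lt_succ_self N
      ⟨hlt.trans h.1, hlt.trans h.2⟩) hN
  rcases h e with hf | hf
  · have := (he {y | P (e, y)}.ncard).1
    rw [hf.cast_ncard_eq] at this
    exact lt_irrefl _ this
  · have := (he {y | Q (e, y)}.ncard).2
    rw [hf.cast_ncard_eq] at this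
    exact lt_irrefl _ this

end Parameters

/-! ### Morley rank: elementary properties -/

section MorleyRank

variable {L : FirstOrder.Language.{u, v}} {M : Type w} [L.Structure M]
variable {ι : Type*} {X Y : Set (ι → M)} {α β : Ordinal.{0}}

theorem MorleyRankGE.nonempty (h : MorleyRankGE L α X) : X.Nonempty := by
  rw [MorleyRankGE] at h
  exact h.1

theorem MorleyRankGE.exists_seq (h : MorleyRankGE L α X) (hβ : β < α) :
    ∃ Y : ℕ → Set (ι → M), (∀ n, Y n ⊆ X ∧ (univ : Set M).Definable L (Y n)) ∧
      Pairwise (fun n m => Disjoint (Y n) (Y m)) ∧ ∀ n, MorleyRankGE L β (Y n) := by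
  rw [MorleyRankGE] at h
  exact h.2 β hβ

theorem morleyRankGE_zero : MorleyRankGE L 0 X ↔ X.Nonempty := by
  refine ⟨MorleyRankGE.nonempty, fun h => ?_⟩
  rw [MorleyRankGE]
  exact ⟨h, fun β hβ => (not_lt_zero hβ).elim⟩

theorem MorleyRankGE.mono_rank (h : MorleyRankGE L α X) (hβ : β ≤ α) : MorleyRankGE L β X := by
  rw [MorleyRankGE]
  exact ⟨h.nonempty, fun γ hγ => h.exists_seq (hγ.trans_le hβ)⟩

theorem MorleyRankGE.mono_set (h : MorleyRankGE L α X) (hXY : X ⊆ Y) : MorleyRankGE L α Y := by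
  rw [MorleyRankGE]
  refine ⟨h.nonempty.mono hXY, fun γ hγ => ?_⟩
  obtain ⟨Z, hZ, hd, hr⟩ := h.exists_seq hγ
  exact ⟨Z, fun n => ⟨(hZ n).1.trans hXY, (hZ n).2⟩, hd, hr⟩

theorem morleyRankGE_succ_of_seq {Y : ℕ → Set (ι → M)}
    (hY : ∀ n, Y n ⊆ X ∧ (univ : Set M).Definable L (Y n))
    (hd : Pairwise fun n m => Disjoint (Y n) (Y m)) (hr : ∀ n, MorleyRankGE L α (Y n)) :
    MorleyRankGE L (Order.succ α) X := by
  rw [MorleyRankGE]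
  exact ⟨(hr 0).nonempty.mono (hY 0).1, fun β hβ =>
    ⟨Y, hY, hd, fun n => (hr n).mono_rank (Order.lt_succ_iff.1 hβ)⟩⟩

theorem morleyRankGE_one_of_infinite [Finite ι] (h : X.Infinite) : MorleyRankGE L 1 X := by
  rw [show (1 : Ordinal.{0}) = Order.succ 0 by simp]
  let e := h.natEmbedding
  refine morleyRankGE_succ_of_seq (Y := fun n => {(e n : ι → M)}) (fun n => ⟨?_, ?_⟩) ?_ ?_
  · exact singleton_subset_iff.2 (e n).2
  · exact definable_setOf_eq _ (subset_univ _)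
  · intro n m hnm
    rw [disjoint_singleton]
    exact fun h => hnm (e.injective (Subtype.ext h))
  · exact fun n => morleyRankGE_zero.2 (singleton_nonempty _)

theorem MorleyRankGE.infinite (h : MorleyRankGE L 1 X) : X.Infinite := by
  obtain ⟨Y, hY, hd, hr⟩ := h.exists_seq zero_lt_one
  choose y hy using fun n => (hr n).nonempty
  refine infinite_of_injective_forall_mem (f := y) (fun n m hnm => ?_) fun n => (hY n).1 (hy n)
  by_contra hne
  exact disjoint_left.1 (hd hne) (hy n) (hnm ▸ hy m)

end MorleyRank

/-! ### Definability of the field operations -/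

namespace DefinableField

variable {L : FirstOrder.Language.{u, v}} {M : Type w} [L.Structure M] {d : ℕ}
variable {K : DefinableField L (∅ : Set M) d} {A : Set M} {E : Type w} [DSort L M E]
variable {f g : E → K.carrier}

theorem defP_add : DefP L A fun v : Fin 3 → K.carrier => v 0 + v 1 = v 2 := by
  refine (congrArg (A.Definable L) ?_).mp (K.definable_add.mono (empty_subset A))
  ext p
  constructor
  · rintro ⟨x, y, h0, h1, h2⟩
    refine ⟨![x, y, x + y], rfl, funext fun q => ?_⟩
    obtain ⟨i, s⟩ := q
    fin_cases i
    · exact (congrFun h0 s).symm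
    · exact (congrFun h1 s).symm
    · exact (congrFun h2 s).symm
  · rintro ⟨v, hv, rfl⟩
    exact ⟨v 0, v 1, rfl, rfl, by rw [show v 0 + v 1 = v 2 from hv]; rfl⟩

theorem defP_mul : DefP L A fun v : Fin 3 → K.carrier => v 0 * v 1 = v 2 := by
  refine (congrArg (A.Definable L) ?_).mp (K.definable_mul.mono (empty_subset A))
  ext p
  constructor
  · rintro ⟨x, y, h0, h1, h2⟩
    refine ⟨![x, y, x * y], rfl, funext fun q => ?_⟩
    obtain ⟨i, s⟩ := q
    fin_cases i
    · exact (congrFun h0 s).symm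
    · exact (congrFun h1 s).symm
    · exact (congrFun h2 s).symm
  · rintro ⟨v, hv, rfl⟩
    exact ⟨v 0, v 1, rfl, rfl, by rw [show v 0 * v 1 = v 2 from hv]; rfl⟩

theorem defF_vec3 {h : E → K.carrier} (hf : DefF L A f) (hg : DefF L A g) (hh : DefF L A h) :
    DefF L A fun x => ![f x, g x, h x] := by
  refine DefF.pi fun i => ?_
  fin_cases i
  · exact hf
  · exact hg
  · exact hh

theorem _root_.IndiscernibleArrays.DefF.add (hf : DefF L A f) (hg : DefF L A g) :
    DefF L A fun x => f x + g x :=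
  DefF.graph.2 <| defP_add.comp
    (defF_vec3 (hf.comp DefF.id.fst) (hg.comp DefF.id.fst) DefF.id.snd)

theorem _root_.IndiscernibleArrays.DefF.mul (hf : DefF L A f) (hg : DefF L A g) :
    DefF L A fun x => f x * g x :=
  DefF.graph.2 <| defP_mul.comp
    (defF_vec3 (hf.comp DefF.id.fst) (hg.comp DefF.id.fst) DefF.id.snd)

theorem defF_zero : DefF L A fun _ : E => (0 : K.carrier) :=
  DefF.graph.2 <| (DefP.eq (DefF.id.snd.add DefF.id.snd) DefF.id.snd).congr fun p => by
    simp [eq_comm]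

theorem defF_one : DefF L A fun _ : E => (1 : K.carrier) :=
  DefF.graph.2 <| ((DefP.eq (DefF.id.snd.mul DefF.id.snd) DefF.id.snd).and
    (DefP.eq DefF.id.snd defF_zero).not).congr fun p => by
      constructor
      · rintro ⟨h, h0⟩
        exact (mul_left_cancel₀ h0 (h.trans (mul_one _).symm)).symm
      · intro h
        simp [← h]

theorem _root_.IndiscernibleArrays.DefF.sub (hf : DefF L A f) (hg : DefF L A g) :
    DefF L A fun x => f x - g x :=
  DefF.graph.2 <| (DefP.eq (DefF.id.snd.add (hg.comp DefF.id.fst))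
    (hf.comp DefF.id.fst)).congr fun p => by
      rw [sub_eq_iff_eq_add]; exact eq_comm

theorem _root_.IndiscernibleArrays.DefF.div (hf : DefF L A f) (hg : DefF L A g) :
    DefF L A fun x => f x / g x :=
  DefF.graph.2 <| (((DefP.eq (hg.comp DefF.id.fst) defF_zero).not.and
    (DefP.eq (DefF.id.snd.mul (hg.comp DefF.id.fst)) (hf.comp DefF.id.fst))).or
    ((DefP.eq (hg.comp DefF.id.fst) defF_zero).and (DefP.eq DefF.id.snd defF_zero))).congr
      fun p => by
        by_cases h : g p.1 = 0
        · simp [h, eq_comm]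
        · simp [h, div_eq_iff h, eq_comm]

end DefinableField

/-! ### Strong minimality of a definable field of Morley rank one -/

/-- A definable sort is strongly minimal: it is infinite and the fibres of any definable family of
its subsets are finite or cofinite, with a uniform bound. -/
structure StronglyMinimal (L : FirstOrder.Language.{u, v}) (M : Type w) [L.Structure M]
    (D : Type w) [DSort L M D] : Prop where
  infinite : Infinite D
  exists_bound : ∀ (E : Type w) [DSort L M E] (P : E × D → Prop), DefP L (univ : Set M) P →
    ∃ N : ℕ, ∀ e, {x | P (e, x)}.encard ≤ (N : ℕ∞) ∨ {x | ¬ P (e, x)}.encard ≤ (N : ℕ∞)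

section Minimality

variable {L : FirstOrder.Language.{u, v}} {M : Type w} [L.Structure M]

/-- `D` has no infinite family of disjoint infinite definable subsets, i.e. `RM(D) ≤ 1`. -/
def NoInfiniteSplitting (L : FirstOrder.Language.{u, v}) (M : Type w) [L.Structure M]
    (D : Type w) [DSort L M D] : Prop :=
  ∀ Y : ℕ → Set D, (∀ n, DefP L (univ : Set M) (· ∈ Y n)) →
    Pairwise (fun n m => Disjoint (Y n) (Y m)) → ∃ n, (Y n).Finite

theorem noInfiniteSplitting_of_not_morleyRankGE {D : Type w} [DSort L M D]
    (h : ¬ MorleyRankGE L (Order.succ 1) (range (code L M (E := D)))) :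
    NoInfiniteSplitting L M D := by
  intro Y hY hd
  by_contra! hinf
  refine h (morleyRankGE_succ_of_seq (Y := fun n => code L M '' Y n) (fun n =>
    ⟨image_subset_range _ _, hY n⟩) (fun n m hnm => ?_) fun n => ?_)
  · exact (disjoint_image_iff (DSort.code_injective (L := L) (M := M))).2 (hd hnm)
  · exact morleyRankGE_one_of_infinite
      ((hinf n).image (DSort.code_injective (L := L) (M := M)).injOn)

/-- A set without infinite splittings contains an infinite definable subset which no definable set
splits into two infinite parts. -/
theorem NoInfiniteSplitting.exists_minimal {D : Type w} [DSort L M D] [Infinite D]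
    (h : NoInfiniteSplitting L M D) :
    ∃ X : Set D, DefP L (univ : Set M) (· ∈ X) ∧ X.Infinite ∧
      ∀ Y : Set D, DefP L (univ : Set M) (· ∈ Y) → (X ∩ Y).Finite ∨ (X \ Y).Finite := by
  by_contra! hsplit
  choose! s hs hs1 hs2 using hsplit
  let T := {X : Set D // DefP L (univ : Set M) (· ∈ X) ∧ X.Infinite}
  let next : T → T := fun X => ⟨X.1 ∩ s X.1, X.2.1.and (hs X.1 X.2.1 X.2.2), hs1 X.1 X.2.1 X.2.2⟩
  let X : ℕ → T := fun n => next^[n] ⟨univ, DefP.true, infinite_univ⟩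
  have hX : ∀ n, (X (n + 1)).1 = (X n).1 ∩ s (X n).1 := fun n => by
    simp only [X, iterate_succ_apply', next]
  have hanti : Antitone fun n => (X n).1 := antitone_nat_of_succ_le fun n => by
    rw [hX]; exact inter_subset_left
  obtain ⟨n, hn⟩ := h (fun n => (X n).1 \ (X (n + 1)).1)
    (fun n => (X n).2.1.and (X (n + 1)).2.1.not) (by
      have : ∀ n m, n < m → Disjoint ((X n).1 \ (X (n + 1)).1) ((X m).1 \ (X (m + 1)).1) := by
        intro n m hnm
        refine disjoint_left.2 fun x hx hx' => hx.2 (hanti (Nat.succ_le_of_lt hnm) hx'.1)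
      intro n m hnm
      rcases lt_or_gt_of_ne hnm with hlt | hlt
      · exact this n m hlt
      · exact (this m n hlt).symm)
  rw [hX, sdiff_self_inter] at hn
  exact hs2 _ (X n).2.1 (X n).2.2 hn

variable {d : ℕ} {K : DefinableField L (∅ : Set M) d}

theorem defF_const_univ {E F : Type w} [DSort L M E] [DSort L M F] (c : F) :
    DefF L (univ : Set M) fun _ : E => c :=
  DefF.const c (subset_univ _)

/-- In a definable field `D` with `RM(D) ≤ 1`, there is a definable minimal set which is, up to
finitely many points, invariant under all translations: the affine group permutes finitely many
classes of minimal sets modulo finite sets, and the subgroup of translations acting trivially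
is a nonzero ideal of the field. -/
theorem exists_minimal_translation_invariant [Infinite K.carrier]
    (h : NoInfiniteSplitting L M K.carrier) :
    ∃ X : Set K.carrier, DefP L (univ : Set M) (· ∈ X) ∧ X.Infinite ∧
      (∀ Y : Set K.carrier, DefP L (univ : Set M) (· ∈ Y) → (X ∩ Y).Finite ∨ (X \ Y).Finite) ∧
      ∀ k, ∀ᶠ y in cofinite, y + k ∈ X ↔ y ∈ X := by
  obtain ⟨X, hX, hXinf, hmin⟩ := h.exists_minimal
  refine ⟨X, hX, hXinf, hmin, ?_⟩
  have htend : ∀ p q : K.carrier, p ≠ 0 → Tendsto (fun x => p * x + q) cofinite cofinite :=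
    fun p q hp => Injective.tendsto_cofinite fun x y hxy =>
      mul_left_cancel₀ hp (add_right_cancel hxy)
  -- the affine images of `X`, as sets `{x | p x + q ∈ X}`
  let Z : {p : K.carrier // p ≠ 0} × K.carrier → Set K.carrier := fun t => {x | t.1.1 * x + t.2 ∈ X}
  have hZ : ∀ t, DefP L (univ : Set M) (· ∈ Z t) := fun t =>
    hX.comp (((defF_const_univ t.1.1).mul DefF.id).add (defF_const_univ t.2))
  have hZmin : ∀ t, ∀ Y : Set K.carrier, DefP L (univ : Set M) (· ∈ Y) →
      (Z t ∩ Y).Finite ∨ (Z t \ Y).Finite := by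
    rintro ⟨⟨p, hp⟩, q⟩ Y hY
    let Y' : Set K.carrier := {x | p⁻¹ * x + -(p⁻¹ * q) ∈ Y}
    have hY' : DefP L (univ : Set M) (· ∈ Y') :=
      hY.comp (((defF_const_univ p⁻¹).mul DefF.id).add (defF_const_univ _))
    have hmem : ∀ x, p * x + q ∈ Y' ↔ x ∈ Y := fun x => by
      have : p⁻¹ * (p * x + q) + -(p⁻¹ * q) = x := by field_simp; ring
      simp only [Y', mem_ofPred_eq, this]
    have hinj : Injective fun x => p * x + q := fun x y hxy =>
      mul_left_cancel₀ hp (add_right_cancel hxy)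
    refine (hmin Y' hY').imp (fun hf => ?_) fun hf => ?_
    · refine (hf.preimage hinj.injOn).subset fun x hx => ?_
      exact ⟨hx.1, (hmem x).2 hx.2⟩
    · refine (hf.preimage hinj.injOn).subset fun x hx => ?_
      exact ⟨hx.1, fun h' => hx.2 ((hmem x).1 h')⟩
  have hZinf : ∀ t, (Z t).Infinite := by
    rintro ⟨⟨p, hp⟩, q⟩ hf
    refine hXinf ((hf.image fun x => p * x + q).subset fun x hx => ?_)
    have : p * (p⁻¹ * (x - q)) + q = x := by field_simp; ring
    refine ⟨p⁻¹ * (x - q), ?_, this⟩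
    change p * (p⁻¹ * (x - q)) + q ∈ X
    rwa [this]
  have hZdisj : ∀ s t, ¬ (∀ᶠ x in cofinite, x ∈ Z s ↔ x ∈ Z t) → (Z s ∩ Z t).Finite := by
    intro s t hst
    by_contra hinf
    have h1 := (hZmin s _ (hZ t)).resolve_left hinf
    have h2 := (hZmin t _ (hZ s)).resolve_left (by rwa [inter_comm])
    refine hst ((h1.union h2).subset fun x hx => ?_)
    by_contra hx'
    simp only [mem_union, Set.mem_sdiff, not_or, not_and, not_not] at hx'
    exact hx ⟨hx'.1, hx'.2⟩
  let c : {p : K.carrier // p ≠ 0} × K.carrier → Germ (cofinite : Filter K.carrier) Prop :=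
    fun t => ((fun x => x ∈ Z t : K.carrier → Prop) : Germ _ _)
  have hc : ∀ s t, c s = c t ↔ ∀ᶠ x in cofinite, x ∈ Z s ↔ x ∈ Z t := fun s t => by
    refine Germ.coe_eq.trans ⟨fun h => h.mono fun x hx => iff_of_eq hx,
      fun h => h.mono fun x hx => propext hx⟩
  have hfin : Finite (range c) := by
    by_contra hninf
    rw [not_finite_iff_infinite] at hninf
    let e := Infinite.natEmbedding (range c)
    choose t ht using fun n => (e n).2
    have hne : ∀ n m, n ≠ m → (Z (t n) ∩ Z (t m)).Finite := fun n m hnm => hZdisj _ _ fun h' =>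
      hnm (e.injective (Subtype.ext (by rw [← ht, ← ht]; exact (hc _ _).2 h')))
    obtain ⟨n, hn⟩ := h (fun n => {x | x ∈ Z (t n) ∧ ∀ m : Fin n, x ∉ Z (t m)})
      (fun n => (hZ _).and (DefP.forall_finite fun m => (hZ _).not)) (by
        have : ∀ n m, n < m → Disjoint {x | x ∈ Z (t n) ∧ ∀ m : Fin n, x ∉ Z (t m)}
            {x | x ∈ Z (t m) ∧ ∀ i : Fin m, x ∉ Z (t i)} := fun n m hnm =>
          disjoint_left.2 fun x hx hx' => hx'.2 ⟨n, hnm⟩ hx.1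
        intro n m hnm
        rcases lt_or_gt_of_ne hnm with hlt | hlt
        · exact this n m hlt
        · exact (this m n hlt).symm)
    refine hZinf (t n) ((hn.union (finite_iUnion fun m : Fin n =>
      hne n m (Nat.ne_of_gt m.2))).subset fun x hx => ?_)
    by_cases hx' : ∀ m : Fin n, x ∉ Z (t m)
    · exact Or.inl ⟨hx, hx'⟩
    · push Not at hx'
      obtain ⟨m, hm⟩ := hx'
      exact Or.inr (mem_iUnion.2 ⟨m, hx, hm⟩)
  -- two distinct translations act in the same way on the finitely many classes
  choose r hr using fun γ : range c => γ.2
  let Φ : K.carrier → range c → range c := fun k γ =>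
    ⟨c ((r γ).1, (r γ).1.1 * k + (r γ).2), mem_range_self _⟩
  obtain ⟨k₁, k₂, hΦ, hk⟩ : ∃ k₁ k₂, Φ k₁ = Φ k₂ ∧ k₁ ≠ k₂ := by
    have := not_injective_infinite_finite Φ
    simpa [Injective] using this
  have hcl : ∀ p : K.carrier, p ≠ 0 →
      ∀ᶠ x in cofinite, p * (x + k₁) ∈ X ↔ p * (x + k₂) ∈ X := by
    intro p hp
    let γ : range c := ⟨c (⟨p, hp⟩, 0), mem_range_self _⟩
    have h0 := (hc _ _).1 (hr γ)
    have h12 := (hc _ _).1 (congrArg Subtype.val (congrFun hΦ γ))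
    have h1 := (htend 1 k₁ one_ne_zero).eventually h0
    have h2 := (htend 1 k₂ one_ne_zero).eventually h0
    filter_upwards [h12, h1, h2] with x h12 h1 h2
    simp only [Z, mem_ofPred_eq, one_mul, add_zero, mul_add, add_assoc] at h12 h1 h2 ⊢
    rw [← h1, ← h2, h12]
  intro k
  by_cases hk0 : k = 0
  · simp [hk0]
  have hk' : k₁ - k₂ ≠ 0 := sub_ne_zero.2 hk
  have hp : k / (k₁ - k₂) ≠ 0 := div_ne_zero hk0 hk'
  have := (htend (k / (k₁ - k₂))⁻¹ (-k₂) (inv_ne_zero hp)).eventually (hcl _ hp)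
  refine this.mono fun y hy => ?_
  have e1 : k / (k₁ - k₂) * ((k / (k₁ - k₂))⁻¹ * y + -k₂ + k₁) = y + k := by
    field_simp; ring
  have e2 : k / (k₁ - k₂) * ((k / (k₁ - k₂))⁻¹ * y + -k₂ + k₂) = y := by
    field_simp; ring
  rwa [e1, e2] at hy

/-- An infinite definable field of Morley rank one in an `ℵ₀`-saturated structure is strongly
minimal. -/
theorem stronglyMinimal_of_noInfiniteSplitting (hsat : OmegaSaturated L M) [Infinite K.carrier]
    (h : NoInfiniteSplitting L M K.carrier) : StronglyMinimal L M K.carrier := by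
  refine ⟨inferInstance, fun E _ P hP => ?_⟩
  obtain ⟨X, hX, hXinf, hmin, hinv⟩ := exists_minimal_translation_invariant h
  have hcof : (Xᶜ).Finite := by
    by_contra hY
    -- for `y ∉ X`, only finitely many `g ∈ X` satisfy `g + y ∉ X`; there is a uniform bound
    have hQ : DefP L (univ : Set M) fun q : K.carrier × K.carrier => q.2 ∈ X ∧ q.2 + q.1 ∉ X :=
      (hX.comp DefF.id.snd).and (hX.comp (DefF.id.snd.add DefF.id.fst)).not
    have hQf : ∀ y, {g | g ∈ X ∧ g + y ∉ X}.Finite := fun y =>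
      (hinv y).subset fun g hg hiff => hg.2 (hiff.2 hg.1)
    obtain ⟨N, hN⟩ := hsat.exists_uniform_bound hQ hQ fun y => Or.inl (hQf y)
    obtain ⟨g, hg, hgX⟩ := lt_encard_iff_exists_injective.1
      (show (N : ℕ∞) < X.encard by rw [hXinf.encard_eq]; exact ENat.natCast_lt_top N)
    have hev : ∀ᶠ y in cofinite, ∀ i, (y + g i ∈ X ↔ y ∈ X) := eventually_all.2 fun i => hinv _
    have hfr : ∃ᶠ y in cofinite, y ∉ X := frequently_cofinite_iff_infinite.2 hY
    obtain ⟨y, hyX, hy⟩ := (hfr.and_eventually hev).exists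
    refine absurd (lt_encard_iff_exists_injective.2 ⟨g, hg, fun i => ?_⟩)
      (not_lt.2 ((or_self_iff).1 (hN y)))
    exact ⟨hgX i, fun h' => hyX ((hy i).1 (by rwa [add_comm]))⟩
  refine hsat.exists_uniform_bound hP hP.not fun e => ?_
  refine (hmin {x | P (e, x)} (hP.fix_univ e)).imp (fun hf => ?_) fun hf => ?_
  · refine (hf.union hcof).subset fun x hx => ?_
    by_cases hxX : x ∈ X
    · exact Or.inl ⟨hxX, hx⟩
    · exact Or.inr hxX
  · refine (hf.union hcof).subset fun x hx => ?_
    by_cases hxX : x ∈ X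
    · exact Or.inl ⟨hxX, hx⟩
    · exact Or.inr hxX

theorem DefinableField.stronglyMinimal (hsat : OmegaSaturated L M)
    (hK : HasMorleyRank L K.carrier 1) : StronglyMinimal L M K.carrier := by
  have : Infinite K.carrier := hK.1.infinite.to_subtype
  refine stronglyMinimal_of_noInfiniteSplitting hsat (noInfiniteSplitting_of_not_morleyRankGE ?_)
  rw [show range (code L M (E := K.carrier)) = K.carrier from Subtype.range_coe]
  exact hK.2

end Minimality

/-! ### Generic tuples of a strongly minimal sort -/

section Generic

variable {L : FirstOrder.Language.{u, v}} {M : Type w} [L.Structure M]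
variable {A : Set M} {D E : Type w} [DSort L M D] [DSort L M E]

namespace StronglyMinimal

variable (hD : StronglyMinimal L M D)
include hD

theorem neBot : (cofinite : Filter D).NeBot :=
  have := hD.infinite
  inferInstance

theorem eventually_or {P : D → Prop} (hP : DefP L (univ : Set M) P) :
    (∀ᶠ x in cofinite, P x) ∨ ∀ᶠ x in cofinite, ¬ P x := by
  have := hD.infinite
  obtain ⟨N, hN⟩ := hD.exists_bound D (fun p => P p.2) (hP.comp DefF.id.snd)
  rcases hN (Classical.arbitrary D) with h | h
  · exact Or.inr ((finite_of_encard_le_coe h).subset fun x hx => not_not.1 hx)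
  · exact Or.inl (finite_of_encard_le_coe h)

theorem not_eventually {P : D → Prop} (hP : DefP L (univ : Set M) P) :
    (¬ ∀ᶠ x in cofinite, P x) ↔ ∀ᶠ x in cofinite, ¬ P x := by
  refine ⟨(hD.eventually_or hP).resolve_left, fun h h' => ?_⟩
  have := hD.neBot
  obtain ⟨x, hx⟩ := (h.and h').exists
  exact hx.1 hx.2

theorem eventually_of_infinite {P : D → Prop} (hP : DefP L (univ : Set M) P)
    (h : {x | P x}.Infinite) : ∀ᶠ x in cofinite, P x :=
  (hD.eventually_or hP).resolve_right fun h' => h (h'.subset fun _ hx => not_not.2 hx)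

theorem exists_bound_of_eventually_not {P : E × D → Prop} (hP : DefP L (univ : Set M) P) :
    ∃ N : ℕ, ∀ e, (∀ᶠ x in cofinite, ¬ P (e, x)) ↔ {x | P (e, x)}.encard ≤ (N : ℕ∞) := by
  have := hD.neBot
  obtain ⟨N, hN⟩ := hD.exists_bound E P hP
  refine ⟨N, fun e => ⟨fun h => (hN e).resolve_right fun h' => ?_, fun h => ?_⟩⟩
  · obtain ⟨x, hx, hx'⟩ := (h.and
      (show ∀ᶠ x in cofinite, P (e, x) from finite_of_encard_le_coe h')).exists
    exact hx hx'
  · exact (finite_of_encard_le_coe h).subset fun x hx => not_not.1 hx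

/-- The quantifier “for all but finitely many `x` in `D`” preserves definability. -/
theorem defP_eventually {P : E × D → Prop} (hP : DefP L A P) :
    DefP L A fun e => ∀ᶠ x in cofinite, P (e, x) := by
  obtain ⟨N, hN⟩ := hD.exists_bound_of_eventually_not (hP.not.mono (subset_univ A))
  exact (hP.not.encard_le N).congr fun e => by simp only [← hN e, not_not]

/-- The quantifiers “for all but finitely many” over a strongly minimal sort commute. This is the
exchange property of algebraic closure. -/
theorem eventually_comm {P : D → D → Prop}
    (hP : DefP L (univ : Set M) fun p : D × D => P p.1 p.2)
    (h : ∀ᶠ x in cofinite, ∀ᶠ y in cofinite, P x y) :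
    ∀ᶠ y in cofinite, ∀ᶠ x in cofinite, P x y := by
  have := hD.neBot
  have := hD.infinite
  have hP' : DefP L (univ : Set M) fun p : D × D => P p.2 p.1 :=
    hP.comp (DefF.id.snd.prodMk DefF.id.fst)
  by_contra hcon
  rw [hD.not_eventually (hD.defP_eventually hP')] at hcon
  obtain ⟨N, hN⟩ := hD.exists_bound_of_eventually_not hP'
  have hinf : {x | ∀ᶠ y in cofinite, P x y}.Infinite := fun hf => by
    obtain ⟨x, hx, hx'⟩ := (h.and (hf.compl_mem_cofinite)).exists
    exact hx' hx
  obtain ⟨x, hx, hxP⟩ := lt_encard_iff_exists_injective.1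
    (show (N : ℕ∞) < _ by rw [hinf.encard_eq]; exact ENat.natCast_lt_top N)
  obtain ⟨y, hy, hyP⟩ := (hcon.and (eventually_all.2 hxP)).exists
  rw [hD.not_eventually (hP'.fix_univ y)] at hy
  exact absurd (lt_encard_iff_exists_injective.2 ⟨x, hx, hyP⟩) (not_lt.2 ((hN y).1 hy))

end StronglyMinimal

/-- The filter of generic sets of `n`-tuples: `P` is generic if for all but finitely many `x₀`,
for all but finitely many `x₁`, …, `P (x₀, …, xₙ₋₁)` holds. -/
def generic (D : Type w) : ∀ n : ℕ, Filter (Fin n → D)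
  | 0 => pure Fin.elim0
  | n + 1 => cofinite.bind fun x => (generic D n).map (Fin.cons x)

theorem eventually_generic_zero {P : (Fin 0 → D) → Prop} :
    (∀ᶠ v in generic D 0, P v) ↔ ∀ v, P v := by
  simp only [generic, eventually_pure]
  exact ⟨fun h v => by rwa [Subsingleton.elim v Fin.elim0], fun h => h _⟩

theorem eventually_generic_succ {n : ℕ} {P : (Fin (n + 1) → D) → Prop} :
    (∀ᶠ v in generic D (n + 1), P v) ↔
      ∀ᶠ x in cofinite, ∀ᶠ v in generic D n, P (Fin.cons x v) := by
  simp only [generic, eventually_bind, eventually_map]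

theorem eventually_generic_snoc : ∀ {n : ℕ} {P : (Fin (n + 1) → D) → Prop},
    (∀ᶠ v in generic D (n + 1), P v) ↔
      ∀ᶠ v in generic D n, ∀ᶠ x in cofinite, P (Fin.snoc v x)
  | 0, P => by
    rw [eventually_generic_succ, eventually_generic_zero]
    simp only [eventually_generic_zero]
    have h : ∀ (x : D) (v w : Fin 0 → D), (Fin.cons x v : Fin 1 → D) = Fin.snoc w x := by
      intro x v w
      funext i
      obtain rfl : i = 0 := Subsingleton.elim (α := Fin 1) i 0
      rfl
    constructor
    · intro H v
      exact H.mono fun x hx => h x v v ▸ hx v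
    · intro H
      exact (H Fin.elim0).mono fun x hx v => (h x v Fin.elim0).symm ▸ hx
  | n + 1, P => by
    rw [eventually_generic_succ, eventually_generic_succ]
    refine eventually_congr (Eventually.of_forall fun y => ?_)
    rw [eventually_generic_snoc]
    simp only [Fin.cons_snoc_eq_snoc_cons]

theorem StronglyMinimal.generic_neBot (hD : StronglyMinimal L M D) :
    ∀ n, (generic D n).NeBot
  | 0 => by simp only [generic]; infer_instance
  | n + 1 => by
    have := hD.neBot
    have := hD.generic_neBot n
    refine neBot_iff.2 fun h => ?_
    have h' : ∀ᶠ v in generic D (n + 1), False := by rw [h]; exact eventually_bot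
    rw [eventually_generic_succ] at h'
    obtain ⟨x, hx⟩ := h'.exists
    exact hx.exists.elim fun _ => id

theorem StronglyMinimal.defP_generic (hD : StronglyMinimal L M D) {n : ℕ} :
    ∀ {E : Type w} [DSort L M E] {P : E × (Fin n → D) → Prop}, DefP L A P →
      DefP L A fun e => ∀ᶠ v in generic D n, P (e, v) := by
  induction n with
  | zero =>
    intro E _ P hP
    exact (DefP.all (P := fun e v => P (e, v)) hP).congr fun e => eventually_generic_zero.symm
  | succ n ih =>
    intro E _ P hP
    simp only [eventually_generic_succ]
    refine hD.defP_eventually (P := fun p : E × D => ∀ᶠ v in generic D n, P (p.1, Fin.cons p.2 v))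
      (ih (P := fun q : (E × D) × (Fin n → D) => P (q.1.1, Fin.cons q.1.2 q.2)) ?_)
    exact hP.comp (DefF.id.fst.fst.prodMk (DefF.id.fst.snd.finCons DefF.id.snd))

theorem StronglyMinimal.not_eventually_generic (hD : StronglyMinimal L M D) {n : ℕ} :
    ∀ {P : (Fin n → D) → Prop}, DefP L (univ : Set M) P →
      ((¬ ∀ᶠ v in generic D n, P v) ↔ ∀ᶠ v in generic D n, ¬ P v) := by
  induction n with
  | zero => exact fun _ => by simp only [generic, eventually_pure]
  | succ n ih =>
    intro P hP
    have hc : DefP L (univ : Set M) fun p : D × (Fin n → D) => P (Fin.cons p.1 p.2) :=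
      hP.comp (DefF.id.fst.finCons DefF.id.snd)
    rw [eventually_generic_succ, eventually_generic_succ,
      hD.not_eventually (hD.defP_generic hc)]
    exact eventually_congr (Eventually.of_forall fun x => ih (hc.fix_univ x))

/-! #### Algebraically independent tuples are generic -/

theorem AlgIndepOver.comp_injective {ι κ : Type*} {d : ℕ} {x : ι → Fin d → M}
    (hx : AlgIndepOver L A x) {σ : κ → ι} (hσ : Injective σ) :
    AlgIndepOver L A fun k => x (σ k) := by
  intro k hk
  refine hx (σ k) (hk.trans (acl_mono (union_subset_union_right _ ?_)))
  simp only [iUnion_subset_iff]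
  intro j hj
  exact subset_biUnion_of_mem (u := fun j => range (x j)) (show σ j ≠ σ k from fun h => hj (hσ h))

variable {d : ℕ} {K : DefinableField L (∅ : Set M) d}

/-- Tuples that are algebraically independent over `A` realize the generic type over `A`. -/
theorem AlgIndepOver.eventually_generic (hK : StronglyMinimal L M K.carrier) {n : ℕ} :
    ∀ {A : Set M} {x : Fin n → K.carrier}, AlgIndepOver L A (fun i => (x i : Fin d → M)) →
      ∀ {P : (Fin n → K.carrier) → Prop}, DefP L A P → P x →
        ∀ᶠ v in generic K.carrier n, P v := by
  induction n with
  | zero =>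
    intro A x _ P _ h
    exact eventually_generic_zero.2 fun v => by rwa [Subsingleton.elim v x]
  | succ n ih =>
    intro A x hx P hP h
    have hc : DefP L A fun p : K.carrier × (Fin n → K.carrier) => P (Fin.cons p.1 p.2) :=
      hP.comp (DefF.id.fst.finCons DefF.id.snd)
    rw [eventually_generic_succ]
    have hW := hK.defP_generic hc
    refine hK.eventually_of_infinite (hW.mono (subset_univ _)) fun hf => ?_
    have htail : AlgIndepOver L (A ∪ range (x 0 : Fin d → M))
        (fun i => (Fin.tail x i : Fin d → M)) := by
      intro i hi
      refine hx i.succ (hi.trans (acl_mono ?_))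
      rw [union_assoc]
      refine union_subset_union_right _ (union_subset ?_ ?_)
      · exact subset_biUnion_of_mem (u := fun j => range (x j : Fin d → M))
          (show (0 : Fin (n + 1)) ≠ i.succ from (Fin.succ_ne_zero i).symm)
      · simp only [iUnion_subset_iff]
        intro j hj
        exact subset_biUnion_of_mem (u := fun j => range (x j : Fin d → M))
          (show j.succ ≠ i.succ from fun h' => hj (Fin.succ_injective _ h'))
    have h0 := ih htail (hc.fix (x 0)) (by rwa [Fin.cons_self_tail])
    exact hx 0 ((DefP.range_code_subset_acl hW hf h0).trans (acl_mono subset_union_left))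

theorem AlgIndepOver.iff_eventually_generic (hK : StronglyMinimal L M K.carrier) {n : ℕ}
    {x : Fin n → K.carrier} (hx : AlgIndepOver L A (fun i => (x i : Fin d → M)))
    {P : (Fin n → K.carrier) → Prop} (hP : DefP L A P) :
    P x ↔ ∀ᶠ v in generic K.carrier n, P v := by
  refine ⟨hx.eventually_generic hK hP, fun h => ?_⟩
  by_contra hn
  have h' := hx.eventually_generic hK hP.not hn
  exact (hK.not_eventually_generic (hP.mono (subset_univ _))).2 h' h

end Generic

/-! ### Morley rank of images of generic sets -/

section Rank

variable {L : FirstOrder.Language.{u, v}} {M : Type w} [L.Structure M]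
variable {A : Set M} {D E F : Type w} [DSort L M D] [DSort L M E] [DSort L M F]

/-- An injective definable image of a generic subset of `Dⁿ` has Morley rank at least `n`. -/
theorem StronglyMinimal.morleyRankGE_image (hD : StronglyMinimal L M D) {n : ℕ} :
    ∀ {P : (Fin n → D) → Prop} {g : (Fin n → D) → E}, DefP L (univ : Set M) P →
      DefF L (univ : Set M) g → InjOn g {v | P v} → (∀ᶠ v in generic D n, P v) →
      MorleyRankGE L n (code L M '' (g '' {v | P v})) := by
  induction n with
  | zero =>
    intro P g _ _ _ h
    rw [Nat.cast_zero, morleyRankGE_zero]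
    exact ⟨_, _, ⟨Fin.elim0, eventually_generic_zero.1 h _, rfl⟩, rfl⟩
  | succ n ih =>
    intro P g hP hg hinj h
    have := hD.neBot
    rw [eventually_generic_succ] at h
    have hinf : {x | ∀ᶠ v in generic D n, P (Fin.cons x v)}.Infinite := fun hf => by
      obtain ⟨x, hx, hx'⟩ := (h.and hf.compl_mem_cofinite).exists
      exact hx' hx
    let e := hinf.natEmbedding
    have hPc : ∀ k, DefP L (univ : Set M) fun v : Fin n → D => P (Fin.cons (e k : D) v) := fun k =>
      hP.comp ((defF_const_univ _).finCons DefF.id)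
    have hgc : ∀ k, DefF L (univ : Set M) fun v : Fin n → D => g (Fin.cons (e k : D) v) := fun k =>
      hg.comp ((defF_const_univ _).finCons DefF.id)
    rw [show ((n + 1 : ℕ) : Ordinal.{0}) = Order.succ (n : Ordinal.{0}) by simp]
    refine morleyRankGE_succ_of_seq
      (Y := fun k => code L M '' ((fun v => g (Fin.cons (e k : D) v)) ''
        {v | P (Fin.cons (e k : D) v)})) (fun k => ⟨?_, ?_⟩) (fun k l hkl => ?_) fun k => ?_
    · refine image_mono ?_
      rintro _ ⟨v, hv, rfl⟩
      exact ⟨_, hv, rfl⟩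
    · have := DefP.ex (P := fun x (v : Fin n → D) =>
        P (Fin.cons (e k : D) v) ∧ g (Fin.cons (e k : D) v) = x)
        (((hPc k).comp DefF.id.snd).and (DefP.eq ((hgc k).comp DefF.id.snd) DefF.id.fst))
      exact this
    · refine (disjoint_image_iff (DSort.code_injective (L := L) (M := M))).2 ?_
      refine disjoint_left.2 ?_
      rintro _ ⟨v, hv, rfl⟩ ⟨v', hv', hvv'⟩
      have := congrFun (hinj hv' hv hvv') 0
      simp only [Fin.cons_zero] at this
      exact hkl (e.injective (Subtype.ext this)).symm
    · refine ih (hPc k) (hgc k) (fun v hv v' hv' hvv' => ?_) (e k).2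
      exact Fin.cons_right_injective (α := fun _ => D) _ (hinj hv hv' hvv')

/-- `S` has dimension at most `k` over `D`: it is covered by finitely many definable
correspondences with `Dᵏ` whose fibres over `Dᵏ` are uniformly finite. -/
def DimLE (L : FirstOrder.Language.{u, v}) (M : Type w) [L.Structure M] (D : Type w) {E : Type w}
    [DSort L M D] [DSort L M E] (k : ℕ) (S : Set E) : Prop :=
  ∃ (J : Type) (_ : Finite J) (R : J → E × (Fin k → D) → Prop) (N : ℕ),
    (∀ j, DefP L (univ : Set M) (R j)) ∧ (∀ x ∈ S, ∃ j t, R j (x, t)) ∧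
    ∀ j t, {x | x ∈ S ∧ R j (x, t)}.encard ≤ (N : ℕ∞)

/-- A definable subset of `Dᵏ⁺¹` which is not generic has dimension at most `k`. -/
theorem StronglyMinimal.dimLE_of_not_generic (hD : StronglyMinimal L M D) {k : ℕ} :
    ∀ {T : (Fin (k + 1) → D) → Prop}, DefP L (univ : Set M) T →
      (¬ ∀ᶠ v in generic D (k + 1), T v) → DimLE L M D k {v | T v} := by
  -- Over the first `k` coordinates, the finite fibres of `T` have a uniform bound, and the points with
  -- infinite fibre project to a nongeneric subset of `Dᵏ`, to which induction applies.
  have key : ∀ {k : ℕ} {T : (Fin (k + 1) → D) → Prop}, DefP L (univ : Set M) T →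
      ∃ N : ℕ, ∀ t : Fin k → D, (∀ᶠ x in cofinite, ¬ T (Fin.snoc t x)) ↔
        {x | T (Fin.snoc t x)}.encard ≤ (N : ℕ∞) := fun {k T} hT =>
    hD.exists_bound_of_eventually_not (P := fun p : (Fin k → D) × D => T (Fin.snoc p.1 p.2))
      (hT.comp (DefF.id.fst.finSnoc DefF.id.snd))
  have hinit : ∀ {k : ℕ}, DefF L (univ : Set M) fun v : Fin (k + 1) → D => Fin.init v :=
    fun {k} => DefF.pi fun i => DefF.id.apply i.castSucc
  have hV : ∀ {k : ℕ} {T : (Fin (k + 1) → D) → Prop}, DefP L (univ : Set M) T →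
      DefP L (univ : Set M) fun t : Fin k → D => ∀ᶠ x in cofinite, T (Fin.snoc t x) :=
    fun {k T} hT => hD.defP_eventually (P := fun p : (Fin k → D) × D => T (Fin.snoc p.1 p.2))
      (hT.comp (DefF.id.fst.finSnoc DefF.id.snd))
  have hfib : ∀ {k : ℕ} {T : (Fin (k + 1) → D) → Prop} (t : Fin k → D) (N : ℕ),
      {x | T (Fin.snoc t x)}.encard ≤ (N : ℕ∞) →
      {v | T v ∧ Fin.init v = t}.encard ≤ (N : ℕ∞) := by
    intro k T t N h
    refine le_trans (le_trans (encard_le_encard ?_)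
      (encard_image_le (fun x => (Fin.snoc t x : Fin (k + 1) → D)) {x | T (Fin.snoc t x)})) h
    rintro v ⟨hv, rfl⟩
    exact ⟨v (Fin.last k), by simpa using hv, Fin.snoc_init_self v⟩
  have hle : ∀ {k : ℕ} {T : (Fin (k + 1) → D) → Prop} {N : ℕ}, DefP L (univ : Set M) T →
      (∀ t : Fin k → D, (∀ᶠ x in cofinite, ¬ T (Fin.snoc t x)) ↔
        {x | T (Fin.snoc t x)}.encard ≤ (N : ℕ∞)) → ∀ t,
      {v | T v ∧ (Fin.init v = t ∧ ¬ ∀ᶠ x in cofinite, T (Fin.snoc (Fin.init v) x))}.encard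
        ≤ (N : ℕ∞) := by
    intro k T N hT hN t
    by_cases h : ∀ᶠ x in cofinite, T (Fin.snoc t x)
    · refine le_of_eq_of_le (encard_eq_zero.2 (eq_empty_of_forall_notMem ?_)) (by simp)
      rintro v ⟨-, rfl, hv⟩
      exact hv h
    · rw [hD.not_eventually (hT.comp ((defF_const_univ t).finSnoc DefF.id)), hN] at h
      exact (encard_le_encard (fun v hv => ⟨hv.1, hv.2.1⟩ :
        _ ⊆ {v | T v ∧ Fin.init v = t})).trans (hfib t N h)
  induction k with
  | zero =>
    intro T hT hg
    obtain ⟨N, hN⟩ := key hT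
    refine ⟨Unit, inferInstance, fun _ _ => True, N, fun _ => DefP.true,
      fun _ _ => ⟨(), Fin.elim0, trivial⟩, fun _ t => ?_⟩
    rw [eventually_generic_snoc, eventually_generic_zero] at hg
    refine (encard_le_encard (fun v hv => ⟨hv.1, Subsingleton.elim _ _, fun h => hg fun w => ?_⟩ :
      _ ⊆ {v | T v ∧ (Fin.init v = t ∧ ¬ ∀ᶠ x in cofinite, T (Fin.snoc (Fin.init v) x))})).trans
      (hle hT hN t)
    rwa [Subsingleton.elim w (Fin.init v)]
  | succ k ih =>
    intro T hT hg
    obtain ⟨N, hN⟩ := key hT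
    rw [eventually_generic_snoc] at hg
    obtain ⟨J, hJ, R, N', hR, hcov, hfin⟩ := ih (hV hT) hg
    refine ⟨Option J, inferInstance, fun j => j.elim
      (fun p => Fin.init p.1 = p.2 ∧ ¬ ∀ᶠ x in cofinite, T (Fin.snoc (Fin.init p.1) x))
      (fun j p => (∀ᶠ x in cofinite, T (Fin.snoc (Fin.init p.1) x)) ∧
        R j (Fin.init p.1, Fin.init p.2) ∧ p.1 (Fin.last _) = p.2 (Fin.last _)),
      max N N', ?_, ?_, ?_⟩
    · rintro (_ | j)
      · exact (DefP.eq (hinit.comp DefF.id.fst) DefF.id.snd).and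
          ((hV hT).comp (hinit.comp DefF.id.fst)).not
      · exact ((hV hT).comp (hinit.comp DefF.id.fst)).and
          (((hR j).comp ((hinit.comp DefF.id.fst).prodMk (hinit.comp DefF.id.snd))).and
            (DefP.eq (DefF.id.fst.apply _) (DefF.id.snd.apply _)))
    · intro v hv
      by_cases h : ∀ᶠ x in cofinite, T (Fin.snoc (Fin.init v) x)
      · obtain ⟨j, t, hjt⟩ := hcov (Fin.init v) h
        exact ⟨some j, Fin.snoc t (v (Fin.last _)), h, by simpa using hjt, by simp⟩
      · exact ⟨none, Fin.init v, rfl, h⟩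
    · rintro (_ | j) t
      · exact (hle hT hN t).trans (by exact_mod_cast le_max_left N N')
      · refine le_trans (le_trans (encard_le_encard ?_) (encard_image_le
          (fun s => (Fin.snoc s (t (Fin.last _)) : Fin (k + 2) → D)) _))
          ((hfin j (Fin.init t)).trans (by exact_mod_cast le_max_right N N'))
        rintro v ⟨-, h, hRv, hlast⟩
        refine ⟨Fin.init v, ⟨h, hRv⟩, ?_⟩
        change Fin.snoc (Fin.init v) (t (Fin.last k)) = v
        rw [← show v (Fin.last _) = t (Fin.last k) from hlast, Fin.snoc_init_self]

theorem encard_biUnion_le {α β : Type*} {s : Set α} {f : α → Set β} {a b : ℕ}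
    (hs : s.encard ≤ (a : ℕ∞)) (hf : ∀ x ∈ s, (f x).encard ≤ (b : ℕ∞)) :
    (⋃ x ∈ s, f x).encard ≤ ((a * b : ℕ) : ℕ∞) := by
  classical
  have hsf := finite_of_encard_le_coe hs
  have hff : ∀ x ∈ s, (f x).Finite := fun x hx => finite_of_encard_le_coe (hf x hx)
  have hU : (⋃ x ∈ s, f x) =
      ↑(hsf.toFinset.attach.biUnion fun x => (hff x.1 (hsf.mem_toFinset.1 x.2)).toFinset) := by
    ext y
    simp
  rw [hU, encard_coe_eq_coe_finsetCard]
  have h1 := Finset.card_biUnion_le_card_mul hsf.toFinset.attach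
    (fun x => (hff x.1 (hsf.mem_toFinset.1 x.2)).toFinset) b fun x _ => by
      have := hf x.1 (hsf.mem_toFinset.1 x.2)
      rw [(hff x.1 (hsf.mem_toFinset.1 x.2)).encard_eq_coe_toFinset_card] at this
      exact_mod_cast this
  rw [Finset.card_attach] at h1
  rw [hsf.encard_eq_coe_toFinset_card] at hs
  exact_mod_cast h1.trans (Nat.mul_le_mul_right b (by exact_mod_cast hs))

/-- Among infinitely many disjoint definable subsets of a set of dimension at most `k`, one
corresponds only to nongeneric subsets of `Dᵏ`: finitely many generic sets have a common point,
and the fibres over it are uniformly finite. -/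
theorem StronglyMinimal.exists_not_generic {E : Type*} (hD : StronglyMinimal L M D) {k N : ℕ}
    {J : Type} [Finite J] {S : Set E} {R : J → E × (Fin k → D) → Prop}
    (hfin : ∀ j t, {x | x ∈ S ∧ R j (x, t)}.encard ≤ (N : ℕ∞)) {Y : ℕ → Set E}
    (hYS : ∀ n, Y n ⊆ S) (hd : Pairwise fun n m => Disjoint (Y n) (Y m)) :
    ∃ n, ∀ j, ¬ ∀ᶠ t in generic D k, ∃ x ∈ Y n, R j (x, t) := by
  by_contra! h
  have := hD.generic_neBot k
  choose j hj using h
  obtain ⟨j₀, hj₀⟩ := Finite.exists_infinite_fiber j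
  let e := Infinite.natEmbedding (j ⁻¹' {j₀})
  have hej : ∀ i, j (e i) = j₀ := fun i => (e i).2
  have hev : ∀ᶠ t in generic D k, ∀ i : Fin (N + 1), ∃ x ∈ Y (e i), R j₀ (x, t) :=
    eventually_all.2 fun i => by
      have := hj (e i)
      rwa [hej i] at this
  obtain ⟨t, ht⟩ := hev.exists
  choose x hxY hxR using ht
  refine absurd (lt_encard_iff_exists_injective (s := {x | x ∈ S ∧ R j₀ (x, t)}).2 ⟨x, fun a b hab => ?_, fun i =>
    ⟨hYS _ (hxY i), hxR i⟩⟩) (not_lt.2 (hfin j₀ t))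
  by_contra hne
  refine disjoint_left.1 (hd fun h => hne (Fin.ext (e.injective (Subtype.ext h)))) (hxY a) ?_
  rw [hab]
  exact hxY b

/-- A set of dimension at most `k` over `D` has Morley rank at most `k`. -/
theorem StronglyMinimal.not_morleyRankGE_of_dimLE (hD : StronglyMinimal L M D) {k : ℕ} :
    ∀ {S : Set E}, DimLE L M D k S →
      ¬ MorleyRankGE L ((k + 1 : ℕ) : Ordinal.{0}) (code L M '' S) := by
  -- a set of rank `k + 1` has a definable subset of rank `k` without generic correspondences
  have key : ∀ {k N : ℕ} {J : Type} [Finite J] {S : Set E} {R : J → E × (Fin k → D) → Prop},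
      (∀ j t, {x | x ∈ S ∧ R j (x, t)}.encard ≤ (N : ℕ∞)) →
      MorleyRankGE L ((k + 1 : ℕ) : Ordinal.{0}) (code L M '' S) →
      ∃ Y : Set E, Y ⊆ S ∧ DefP L (univ : Set M) (· ∈ Y) ∧
        MorleyRankGE L (k : Ordinal.{0}) (code L M '' Y) ∧
        ∀ j, ¬ ∀ᶠ t in generic D k, ∃ x ∈ Y, R j (x, t) := by
    intro k N J _ S R hfin hr
    obtain ⟨Y, hY, hd, hYr⟩ := hr.exists_seq
      (show (k : Ordinal.{0}) < ((k + 1 : ℕ) : Ordinal.{0}) by exact_mod_cast Nat.lt_succ_self k)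
    have himg : ∀ n, code L M '' (code L M ⁻¹' Y n : Set E) = Y n := fun n =>
      image_preimage_eq_of_subset ((hY n).1.trans (image_subset_range _ _))
    have hYS : ∀ n, (code L M ⁻¹' Y n : Set E) ⊆ S := fun n x hx => by
      obtain ⟨y, hy, hyx⟩ := (hY n).1 hx
      rwa [← code_inj.1 hyx]
    obtain ⟨n, hn⟩ := hD.exists_not_generic hfin hYS fun n m hnm => (hd hnm).preimage _
    exact ⟨_, hYS n, Definable.defP (hY n).2, (himg n).symm ▸ hYr n, hn⟩
  induction k with
  | zero =>
    rintro S ⟨J, _, R, N, hR, hcov, hfin⟩ hr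
    obtain ⟨Y, hYS, -, hYr, hY⟩ := key hfin hr
    obtain ⟨_, x, hx, -⟩ := hYr.nonempty
    obtain ⟨j, t, hjt⟩ := hcov x (hYS hx)
    refine hY j (eventually_generic_zero.2 fun v => ⟨x, hx, ?_⟩)
    rwa [Subsingleton.elim v t]
  | succ k ih =>
    rintro S ⟨J, _, R, N, hR, hcov, hfin⟩ hr
    obtain ⟨Y, hYS, hYd, hYr, hY⟩ := key hfin hr
    have hT : ∀ j, DefP L (univ : Set M) fun t => ∃ x, x ∈ Y ∧ R j (x, t) := fun j =>
      DefP.ex (P := fun t x => x ∈ Y ∧ R j (x, t))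
        ((hYd.comp DefF.id.snd).and ((hR j).comp (DefF.id.snd.prodMk DefF.id.fst)))
    choose J' hJ' R' N' hR' hcov' hfin' using fun j => hD.dimLE_of_not_generic (hT j) (hY j)
    obtain ⟨N₀, hN₀⟩ := Finite.exists_le N'
    refine ih ⟨Σ j, J' j, inferInstance, fun i p => ∃ t, R i.1 (p.1, t) ∧ R' i.1 i.2 (t, p.2),
      N₀ * N, fun i => ?_, fun x hx => ?_, fun i s => ?_⟩ hYr
    · exact DefP.ex (P := fun (p : E × (Fin k → D)) t => R i.1 (p.1, t) ∧ R' i.1 i.2 (t, p.2))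
        (((hR _).comp (DefF.id.fst.fst.prodMk DefF.id.snd)).and
          ((hR' _ _).comp (DefF.id.snd.prodMk DefF.id.fst.snd)))
    · obtain ⟨j, t, hjt⟩ := hcov x (hYS hx)
      obtain ⟨i, s, his⟩ := hcov' j t ⟨x, hx, hjt⟩
      exact ⟨⟨j, i⟩, s, t, hjt, his⟩
    · refine (encard_le_encard ?_).trans (encard_biUnion_le
        ((hfin' i.1 i.2 s).trans (by exact_mod_cast hN₀ i.1)) fun t _ => hfin i.1 t)
      rintro x ⟨hx, t, hxt, hts⟩
      exact mem_biUnion (x := t) ⟨⟨x, hx, hxt⟩, hts⟩ ⟨hYS hx, hxt⟩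

/-- A definable image of `Dᵏ` has Morley rank at most `k`. -/
theorem StronglyMinimal.not_morleyRankGE_range (hD : StronglyMinimal L M D) {k : ℕ}
    {g : (Fin k → D) → E} (hg : DefF L (univ : Set M) g) :
    ¬ MorleyRankGE L (Order.succ (k : Ordinal.{0})) (code L M '' range g) := by
  have := hD.not_morleyRankGE_of_dimLE (k := k) (S := range g) ⟨Unit, inferInstance,
    fun _ p => g p.2 = p.1, 1, fun _ => DefP.eq (hg.comp DefF.id.snd) DefF.id.fst,
    fun _ ⟨t, ht⟩ => ⟨(), t, ht⟩, fun _ t => ?_⟩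
  · rwa [show ((k + 1 : ℕ) : Ordinal.{0}) = Order.succ (k : Ordinal.{0}) by simp] at this
  · rw [Nat.cast_one, encard_le_one_iff]
    rintro x y ⟨-, hx⟩ ⟨-, hy⟩
    exact hx.symm.trans hy

end Rank

/-! ### Indiscernibility and rank function of the twisted array -/

section Array

variable {L : FirstOrder.Language.{u, v}} {M : Type w} [L.Structure M]
variable {A C : Set M} {d : ℕ} {K : DefinableField L (∅ : Set M) d} {E : Type w} [DSort L M E]

/-- A member of an algebraically independent family does not lie in a finite set that is definable
over the other members. -/
theorem AlgIndepOver.not_of_finite {ι : Type*} {x : ι → K.carrier}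
    (hx : AlgIndepOver L C (fun i => (x i : Fin d → M))) (i : ι) {c : E}
    (hc : range (code L M c) ⊆ ⋃ j ∈ {j | j ≠ i}, range (x j : Fin d → M))
    {S : E × K.carrier → Prop} (hS : DefP L C S) (hf : {y | S (c, y)}.Finite) : ¬ S (c, x i) :=
  fun h => hx i (((hS.fix c).range_code_subset_acl hf h).trans
    (acl_mono (union_subset_union_right _ hc)))

theorem AlgIndepOver.add_ne_zero {ι : Type*} {x : ι → K.carrier}
    (hx : AlgIndepOver L C (fun i => (x i : Fin d → M))) {i j : ι} (hij : i ≠ j) :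
    x i + x j ≠ 0 :=
  hx.not_of_finite i (c := x j) (S := fun p => p.2 + p.1 = 0)
    (subset_biUnion_of_mem (u := fun j => range (x j : Fin d → M)) hij.symm)
    (DefP.eq (DefF.id.snd.add DefF.id.fst) DefinableField.defF_zero)
    ((finite_singleton (-x j)).subset fun _ hy => eq_neg_of_add_eq_zero_left hy)

theorem AlgIndepOver.ne {ι : Type*} {x : ι → K.carrier}
    (hx : AlgIndepOver L C (fun i => (x i : Fin d → M))) {i j : ι} (hij : i ≠ j) :
    x i ≠ x j :=
  hx.not_of_finite i (c := x j) (S := fun p => p.2 = p.1)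
    (subset_biUnion_of_mem (u := fun j => range (x j : Fin d → M)) hij.symm)
    (DefP.eq DefF.id.snd DefF.id.fst)
    ((finite_singleton (x j)).subset fun _ hy => hy)

/-- The entries of the twisted array, as elements of the field. -/
noncomputable def twistedEntry (a : Fin 3 → ℕ → K.carrier) (i : Fin 3 → ℕ) : K.carrier :=
  (a 0 (i 0) + a 1 (i 1)) / (a 2 (i 2) + a 1 (i 1))

theorem twistedArray_eq (a : Fin 3 → ℕ → K.carrier) (i : Fin 3 → ℕ) :
    twistedArray L K a i = code L M (twistedEntry a i) := rfl

/-- The entries of the twisted array are not algebraic over a set over which the parameters are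
independent. -/
theorem twistedEntry_not_algebraic {a : Fin 3 → ℕ → K.carrier}
    (ha : AlgIndepOver L C (fun p : Fin 3 × ℕ => (a p.1 p.2 : Fin d → M))) (i : Fin 3 → ℕ)
    {P : K.carrier → Prop} (hP : DefP L C P) (hf : {x | P x}.Finite) : ¬ P (twistedEntry a i) := by
  have hs : a 2 (i 2) + a 1 (i 1) ≠ 0 :=
    ha.add_ne_zero (x := fun p : Fin 3 × ℕ => a p.1 p.2) (i := (2, i 2)) (j := (1, i 1)) (by simp)
  refine ha.not_of_finite (x := fun p : Fin 3 × ℕ => a p.1 p.2) (0, i 0)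
    (c := (a 1 (i 1), a 2 (i 2))) (S := fun p => P ((p.2 + p.1.1) / (p.1.2 + p.1.1))) ?_
    (hP.comp ((DefF.id.snd.add DefF.id.fst.fst).div (DefF.id.fst.snd.add DefF.id.fst.fst))) ?_
  · rintro _ ⟨k | k, rfl⟩
    · exact mem_biUnion (x := ((1 : Fin 3), i 1)) (by simp) ⟨k, rfl⟩
    · exact mem_biUnion (x := ((2 : Fin 3), i 2)) (by simp) ⟨k, rfl⟩
  · refine Finite.preimage (Injective.injOn fun x y hxy => ?_) hf
    exact add_right_cancel ((div_left_inj' hs).1 hxy)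

/-- An element of `K` outside all finite `∅`-definable subsets of `K` has Morley rank one. -/
theorem hasTupleRank_one (hK : HasMorleyRank L K.carrier 1) {x : K.carrier}
    (hx : ∀ P : K.carrier → Prop, DefP L (∅ : Set M) P → {x | P x}.Finite → ¬ P x) :
    HasTupleRank L (x : Fin d → M) 1 := by
  refine ⟨⟨K.carrier, K.definable_carrier, x.2, hK⟩, fun X hX hxX => ?_⟩
  have hinf : {y : K.carrier | code L M y ∈ X}.Infinite := fun hf =>
    hx _ (Definable.defP hX) hf hxX
  refine (morleyRankGE_one_of_infinite
    (hinf.image (DSort.code_injective (L := L) (M := M)).injOn)).mono_set ?_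
  rintro _ ⟨y, hy, rfl⟩
  exact hy

/-- Any subarray of side `m` is the same definable function of `3 m` independent parameters, and all
independent tuples have the same type. -/
theorem isIndiscernibleArray_twistedArray (hsm : StronglyMinimal L M K.carrier)
    (hK : HasMorleyRank L K.carrier 1) {a : Fin 3 → ℕ → K.carrier}
    (ha : AlgIndepOver L (∅ : Set M) (fun p : Fin 3 × ℕ => (a p.1 p.2 : Fin d → M))) :
    IsIndiscernibleArray L (twistedArray L K a) := by
  refine ⟨fun i => hasTupleRank_one hK fun P hP hf => twistedEntry_not_algebraic ha i hP hf,
    fun m j hj φ => ?_⟩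
  let e : Fin 3 × Fin m ≃ Fin (3 * m) := finProdFinEquiv
  -- the block of side `m` as a definable function of its `3 m` parameters
  let F : (Fin (3 * m) → K.carrier) → (Fin 3 → Fin m) → K.carrier := fun x p =>
    (x (e (0, p 0)) + x (e (1, p 1))) / (x (e (2, p 2)) + x (e (1, p 1)))
  have hF : DefF L (∅ : Set M) F := DefF.pi fun p =>
    ((DefF.id.apply _).add (DefF.id.apply _)).div ((DefF.id.apply _).add (DefF.id.apply _))
  have hP : DefP L (∅ : Set M) fun x => code L M (F x) ∈ {v | φ.Realize v} :=
    (Definable.defP (E := (Fin 3 → Fin m) → K.carrier)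
      (empty_definable_iff.2 ⟨φ, rfl⟩)).comp hF
  have key : ∀ j : Fin 3 → Fin m → ℕ, (∀ t, StrictMono (j t)) →
      (φ.Realize (fun p : (Fin 3 → Fin m) × Fin d =>
        twistedArray L K a (fun t => j t (p.1 t)) p.2) ↔
      ∀ᶠ x in generic K.carrier (3 * m), code L M (F x) ∈ {v | φ.Realize v}) := by
    intro j hj
    have hinj : Injective fun l : Fin (3 * m) => ((e.symm l).1, j (e.symm l).1 (e.symm l).2) := by
      intro l l' h
      have h1 : (e.symm l).1 = (e.symm l').1 := (Prod.ext_iff.1 h).1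
      have h2 : j (e.symm l).1 (e.symm l).2 = j (e.symm l').1 (e.symm l').2 := (Prod.ext_iff.1 h).2
      rw [h1] at h2
      exact e.symm.injective (Prod.ext h1 ((hj _).injective h2))
    have hx : AlgIndepOver L (∅ : Set M) (fun l : Fin (3 * m) =>
        (a (e.symm l).1 (j (e.symm l).1 (e.symm l).2) : Fin d → M)) := ha.comp_injective hinj
    rw [← hx.iff_eventually_generic (x := fun l => a (e.symm l).1 (j (e.symm l).1 (e.symm l).2))
      hsm hP]
    refine iff_of_eq (congrArg φ.Realize (funext fun p => ?_))
    simp [twistedArray_eq, twistedEntry, F, code, DSort.code]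
  rw [key j hj]
  exact (key (fun _ k => k) fun _ => Fin.val_strictMono).symm

/-! #### Normalized parameters of a block -/

section Block

variable {m : Fin 3 → ℕ} (hm : ∀ t, 1 ≤ m t)
include hm

/-- The block of side lengths `m` with `b₀`, `c₀` prescribed, as a function of its remaining
`m₀ + m₁ + m₂ - 2` parameters, listed in the order `a₀, a₁, …, b₁, b₂, …, c₁, c₂, …`. -/
noncomputable def blockMap (b₀ c₀ : K.carrier) (v : Fin (m 0 + m 1 + m 2 - 2) → K.carrier)
    (p : ∀ t, Fin (m t)) : K.carrier :=
  have h0 := (p 0).2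
  have h1 := (p 1).2
  have h2 := (p 2).2
  have h1' := hm 1
  have h2' := hm 2
  let b := if h : (p 1 : ℕ) = 0 then b₀ else v ⟨m 0 + (p 1 - 1), by omega⟩
  let c := if h : (p 2 : ℕ) = 0 then c₀ else v ⟨m 0 + (m 1 - 1) + (p 2 - 1), by omega⟩
  (v ⟨p 0, by omega⟩ + b) / (c + b)

theorem DefF.blockMap {b c : E → K.carrier} {v : E → Fin (m 0 + m 1 + m 2 - 2) → K.carrier}
    (hb : DefF L A b) (hc : DefF L A c) (hv : DefF L A v) :
    DefF L A fun x => blockMap hm (b x) (c x) (v x) := by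
  refine DefF.pi fun p => ?_
  have hB : DefF L A fun x => if h : (p 1 : ℕ) = 0 then b x else v x ⟨m 0 + (p 1 - 1), by
      have := (p 1).2; have := hm 2; omega⟩ := by
    split_ifs
    · exact hb
    · exact hv.apply _
  have hC : DefF L A fun x => if h : (p 2 : ℕ) = 0 then c x else
      v x ⟨m 0 + (m 1 - 1) + (p 2 - 1), by have := (p 2).2; have := hm 1; omega⟩ := by
    split_ifs
    · exact hc
    · exact hv.apply _
  exact ((hv.apply _).add hB).div (hC.add hB)

/-- The parameters of a block other than `b₀`, `c₀` can be recovered from it. -/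
theorem blockMap_injOn {b₀ c₀ : K.carrier} (h : c₀ + b₀ ≠ 0)
    {v v' : Fin (m 0 + m 1 + m 2 - 2) → K.carrier}
    (hv : ∀ l, v l ≠ c₀ ∧ v l + b₀ ≠ 0 ∧ c₀ + v l ≠ 0)
    (hv' : ∀ l, v' l ≠ c₀ ∧ v' l + b₀ ≠ 0 ∧ c₀ + v' l ≠ 0)
    (hvv' : blockMap hm b₀ c₀ v = blockMap hm b₀ c₀ v') : v = v' := by
  have h0' := hm 0
  have h1' := hm 1
  have h2' := hm 2
  have hentry : ∀ i j k (hi : i < m 0) (hj : j < m 1) (hk : k < m 2),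
      blockMap hm b₀ c₀ v (fun t => ⟨![i, j, k] t, by
        revert t; simp [Fin.forall_fin_succ, hi, hj, hk]⟩) =
      blockMap hm b₀ c₀ v' (fun t => ⟨![i, j, k] t, by
        revert t; simp [Fin.forall_fin_succ, hi, hj, hk]⟩) :=
    fun i j k hi hj hk => congrFun hvv' _
  have hA : ∀ i (hi : i < m 0), v ⟨i, by omega⟩ = v' ⟨i, by omega⟩ := by
    intro i hi
    have : (v ⟨i, by omega⟩ + b₀) / (c₀ + b₀) = (v' ⟨i, by omega⟩ + b₀) / (c₀ + b₀) :=
      hentry i 0 0 hi (by omega) (by omega)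
    exact add_right_cancel ((div_left_inj' h).1 this)
  have h00 := hA 0 (by omega)
  funext ⟨l, hl⟩
  rcases lt_or_ge l (m 0) with hl0 | hl0
  · exact hA l hl0
  rcases lt_or_ge l (m 0 + (m 1 - 1)) with hl1 | hl1
  · have : (v ⟨0, by omega⟩ + v ⟨m 0 + (l - m 0), by omega⟩) / (c₀ + v ⟨m 0 + (l - m 0), by omega⟩) =
        (v' ⟨0, by omega⟩ + v' ⟨m 0 + (l - m 0), by omega⟩) /
          (c₀ + v' ⟨m 0 + (l - m 0), by omega⟩) :=
      hentry 0 (l - m 0 + 1) 0 (by omega) (by omega) (by omega)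
    simp only [Nat.add_sub_cancel' hl0, h00] at this
    rw [div_eq_div_iff (hv _).2.2 (hv' _).2.2] at this
    have hne := sub_ne_zero.2 (hv' ⟨0, by omega⟩).1
    have h0 : (v' ⟨0, by omega⟩ - c₀) * (v ⟨l, hl⟩ - v' ⟨l, hl⟩) = 0 := by
      linear_combination -this
    exact sub_eq_zero.1 ((mul_eq_zero.1 h0).resolve_left hne)
  · have : (v ⟨0, by omega⟩ + b₀) / (v ⟨m 0 + (m 1 - 1) + (l - (m 0 + (m 1 - 1))), by omega⟩ + b₀) =
        (v' ⟨0, by omega⟩ + b₀) /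
          (v' ⟨m 0 + (m 1 - 1) + (l - (m 0 + (m 1 - 1))), by omega⟩ + b₀) :=
      hentry 0 0 (l - (m 0 + (m 1 - 1)) + 1) (by omega) (by omega) (by omega)
    simp only [Nat.add_sub_cancel' hl1, h00] at this
    rw [div_eq_div_iff (hv _).2.1 (hv' _).2.1] at this
    exact (add_right_cancel (mul_left_cancel₀ (hv' _).2.1 this)).symm

/-- Every block is a block with `b₀ = 0` and `c₀ = 1`: the array is invariant under the affine
transformations `a ↦ (a + b₀) / s`, `b ↦ (b - b₀) / s`, `c ↦ (c + b₀) / s` of its parameters. -/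
theorem blockMap_mem_range {b₀ c₀ : K.carrier} (h : c₀ + b₀ ≠ 0)
    (v : Fin (m 0 + m 1 + m 2 - 2) → K.carrier) :
    blockMap hm b₀ c₀ v ∈ range (blockMap hm (0 : K.carrier) 1) := by
  have h0' := hm 0
  have h1' := hm 1
  have h2' := hm 2
  refine ⟨fun l => if (l : ℕ) < m 0 then (v l + b₀) / (c₀ + b₀) else
    if (l : ℕ) < m 0 + (m 1 - 1) then (v l - b₀) / (c₀ + b₀) else (v l + b₀) / (c₀ + b₀), ?_⟩
  have key : ∀ x y z x' y' z' : K.carrier, x' = (x + b₀) / (c₀ + b₀) → y' = (y - b₀) / (c₀ + b₀) →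
      z' = (z + b₀) / (c₀ + b₀) → (x' + y') / (z' + y') = (x + y) / (z + y) := by
    rintro x y z _ _ _ rfl rfl rfl
    rw [← add_div, ← add_div, div_div_div_cancel_right₀ h]
    congr 1 <;> ring
  funext p
  have hp0 := (p 0).2
  have hp1 := (p 1).2
  refine key _ _ _ _ _ _ ?_ ?_ ?_
  · simp [hp0]
  · by_cases hp : (p 1 : ℕ) = 0
    · simp [hp]
    · have : m 0 + ((p 1 : ℕ) - 1) < m 0 + (m 1 - 1) := by omega
      simp only [dif_neg hp, this, if_true]
      rw [if_neg (by omega)]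
  · by_cases hp : (p 2 : ℕ) = 0
    · simp [hp, div_self h]
    · simp only [dif_neg hp]
      rw [if_neg (by omega), if_neg (by omega)]

end Block

/-- The block of side lengths `m` has the rank `r = m₀ + m₁ + m₂ - 2` of its normalized parameters: it
lies in a definable image of `Kʳ`, and each `∅`-definable set that contains it contains an injective
image of a generic subset of `Kʳ`, obtained by fixing generic values of `b₀` and `c₀`. -/
theorem hasRankSumSubTwo_twistedArray (hsm : StronglyMinimal L M K.carrier)
    {a : Fin 3 → ℕ → K.carrier}
    (ha : AlgIndepOver L (∅ : Set M) (fun p : Fin 3 × ℕ => (a p.1 p.2 : Fin d → M))) :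
    HasRankSumSubTwo L (twistedArray L K a) := by
  intro m hm
  have h0' := hm 0
  have h1' := hm 1
  have h2' := hm 2
  let r := m 0 + m 1 + m 2 - 2
  -- the indices of the parameters of the block other than `b₀`, `c₀`
  let σ : Fin r → Fin 3 × ℕ := fun l => if (l : ℕ) < m 0 then (0, l) else
    if (l : ℕ) < m 0 + (m 1 - 1) then (1, l - m 0 + 1) else (2, l - (m 0 + (m 1 - 1)) + 1)
  let τ : Fin (r + 2) → Fin 3 × ℕ := Fin.cons (1, 0) (Fin.cons (2, 0) σ)
  have hσ1 : ∀ l, σ l ≠ (1, 0) := by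
    intro l
    simp only [σ]
    split_ifs <;> simp
  have hσ2 : ∀ l, σ l ≠ (2, 0) := by
    intro l
    simp only [σ]
    split_ifs <;> simp
  have hσinj : Injective σ := by
    intro l l' h
    simp only [σ] at h
    refine Fin.ext ?_
    split_ifs at h <;> simp at h <;> omega
  have hτ : Injective τ := by
    refine Fin.cons_injective_iff.2 ⟨?_, Fin.cons_injective_iff.2 ⟨?_, hσinj⟩⟩
    · rintro ⟨i, hi⟩
      refine Fin.cases ?_ (fun l hl => ?_) i hi
      · simp
      · exact hσ1 l hl
    · rintro ⟨l, hl⟩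
      exact hσ2 l hl
  let v : Fin r → K.carrier := fun l => a (σ l).1 (σ l).2
  have hb : a 2 0 + a 1 0 ≠ 0 :=
    ha.add_ne_zero (x := fun p : Fin 3 × ℕ => a p.1 p.2) (i := (2, 0)) (j := (1, 0)) (by simp)
  have hblock : block (twistedArray L K a) m = code L M (blockMap hm (a 1 0) (a 2 0) v) := by
    funext ⟨p, s⟩
    have hp0 := (p 0).2
    have hp1 := (p 1).2
    refine congrArg (fun x : K.carrier => (x : Fin d → M) s) ?_
    have e0 : v ⟨p 0, by omega⟩ = a 0 (p 0) := by simp [v, σ, hp0]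
    have e1 : (if h : (p 1 : ℕ) = 0 then a 1 0 else v ⟨m 0 + (p 1 - 1), by omega⟩) = a 1 (p 1) := by
      split_ifs with h
      · rw [h]
      · have : m 0 + ((p 1 : ℕ) - 1) < m 0 + (m 1 - 1) := by omega
        simp only [v, σ, this, if_true]
        rw [if_neg (by omega)]
        simp only
        congr 1
        omega
    have e2 : (if h : (p 2 : ℕ) = 0 then a 2 0 else
        v ⟨m 0 + (m 1 - 1) + (p 2 - 1), by have := (p 2).2; omega⟩) = a 2 (p 2) := by
      split_ifs with h
      · rw [h]
      · simp only [v, σ]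
        rw [if_neg (by omega), if_neg (by omega)]
        simp only
        congr 1
        omega
    simp only [blockMap]
    rw [e0, e1, e2]
  have hlower : ∀ X : Set ((∀ t, Fin (m t)) × Fin d → M), (∅ : Set M).Definable L X →
      block (twistedArray L K a) m ∈ X → MorleyRankGE L (r : Ordinal.{0}) X := by
    intro X hX hmem
    rw [hblock] at hmem
    let P : (Fin (r + 2) → K.carrier) → Prop := fun x =>
      code L M (blockMap hm (x 0) (x 1) (fun l : Fin r => x l.succ.succ)) ∈ X ∧ x 1 + x 0 ≠ 0 ∧
      ∀ l : Fin r, x l.succ.succ ≠ x 1 ∧ x l.succ.succ + x 0 ≠ 0 ∧ x 1 + x l.succ.succ ≠ 0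
    have hP : DefP L (∅ : Set M) P := by
      refine ((Definable.defP (E := (∀ t, Fin (m t)) → K.carrier) hX).comp
        (DefF.blockMap hm (DefF.id.apply 0) (DefF.id.apply 1)
          (DefF.pi fun l => DefF.id.apply _))).and
        ((DefP.eq ((DefF.id.apply 1).add (DefF.id.apply 0)) DefinableField.defF_zero).not.and
        (DefP.forall_finite fun l => (DefP.eq (DefF.id.apply _) (DefF.id.apply 1)).not.and
          ((DefP.eq ((DefF.id.apply _).add (DefF.id.apply 0)) DefinableField.defF_zero).not.and
          (DefP.eq ((DefF.id.apply 1).add (DefF.id.apply _)) DefinableField.defF_zero).not)))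
    have hgen : ∀ᶠ x in generic K.carrier (r + 2), P x := by
      refine (ha.comp_injective hτ).eventually_generic (x := fun l => a (τ l).1 (τ l).2) hsm hP
        ⟨hmem, hb, fun l => ⟨?_, ?_, ?_⟩⟩
      · exact ha.ne (x := fun p : Fin 3 × ℕ => a p.1 p.2) (i := σ l) (j := (2, 0)) (hσ2 l)
      · exact ha.add_ne_zero (x := fun p : Fin 3 × ℕ => a p.1 p.2) (i := σ l) (j := (1, 0)) (hσ1 l)
      · exact ha.add_ne_zero (x := fun p : Fin 3 × ℕ => a p.1 p.2) (i := (2, 0)) (j := σ l)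
          (hσ2 l).symm
    have := hsm.neBot
    have := hsm.generic_neBot r
    rw [eventually_generic_succ] at hgen
    obtain ⟨b₀, hgen⟩ := hgen.exists
    rw [eventually_generic_succ] at hgen
    obtain ⟨c₀, hgen⟩ := hgen.exists
    obtain ⟨_, -, hbc, -⟩ := hgen.exists
    refine (hsm.morleyRankGE_image (g := blockMap hm b₀ c₀)
      (hP.mono (empty_subset _) |>.comp ((defF_const_univ b₀).finCons
        ((defF_const_univ c₀).finCons DefF.id)))
      (DefF.blockMap hm (defF_const_univ b₀) (defF_const_univ c₀) DefF.id)
      (fun x hx y hy hxy => blockMap_injOn hm hbc hx.2.2 hy.2.2 hxy) hgen).mono_set ?_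
    rintro _ ⟨_, ⟨x, hx, rfl⟩, rfl⟩
    exact hx.1
  have hdef : (∅ : Set M).Definable L (code L M '' range (blockMap (K := K) hm 0 1)) :=
    DefP.ex (P := fun y x => blockMap (K := K) hm 0 1 x = y)
      (DefP.eq ((DefF.blockMap hm DefinableField.defF_zero DefinableField.defF_one DefF.id).comp
        DefF.id.snd) DefF.id.fst)
  have hmem : block (twistedArray L K a) m ∈ code L M '' range (blockMap (K := K) hm 0 1) :=
    hblock ▸ mem_image_of_mem _ (blockMap_mem_range hm hb v)
  exact ⟨⟨_, hdef, hmem, hlower _ hdef hmem, hsm.not_morleyRankGE_range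
    (DefF.blockMap hm (defF_const_univ 0) (defF_const_univ 1) DefF.id)⟩, hlower⟩

end Array

/-! ### Lines of the unit cube and their common algebraic closure -/

section Lines

variable {L : FirstOrder.Language.{u, v}} {M : Type w} [L.Structure M]
variable {C : Set M} {D : Type w} [DSort L M D]

theorem StronglyMinimal.eventually_of_injOn (hD : StronglyMinimal L M D) {P : D → Prop}
    (hP : DefP L (univ : Set M) P) {f : D → D} {S : Set D} (hS : S ∈ (cofinite : Filter D))
    (hf : InjOn f S) (h : ∀ᶠ y in cofinite, P (f y)) : ∀ᶠ v in cofinite, P v := by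
  have := hD.infinite
  have hfin : ({y | P (f y)} ∩ S)ᶜ.Finite := inter_mem h hS
  refine hD.eventually_of_infinite hP ((hfin.infinite_compl.image
    (f := f) (hf.mono ?_)).mono ?_)
  · rw [compl_compl]
    exact inter_subset_right
  · rw [compl_compl]
    rintro _ ⟨y, hy, rfl⟩
    exact hy.1

/-- A triangular change of variables preserves genericity of pairs: if `(y, x) ↦ h₁ y x` has, for
fixed `y`, the inverse `u ↦ k u y`, and `y ↦ h₂ y (k u y)` is injective for fixed `u`, then
`(h₁ y x, h₂ y x)` is a generic pair when `(y, x)` is. -/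
theorem StronglyMinimal.eventually_of_triangular (hD : StronglyMinimal L M D) {T : D → D → Prop}
    (hT : DefP L (univ : Set M) fun p : D × D => T p.1 p.2) {h₁ h₂ k : D → D → D}
    (hdef : DefF L (univ : Set M) fun p : D × D => h₂ p.2 (k p.1 p.2))
    (hk : ∀ᶠ y in cofinite, ∀ᶠ x in cofinite, k (h₁ y x) y = x)
    (hinj : ∀ᶠ u in cofinite, ∃ S ∈ (cofinite : Filter D), InjOn (fun y => h₂ y (k u y)) S)
    (h : ∀ᶠ y in cofinite, ∀ᶠ x in cofinite, T (h₁ y x) (h₂ y x)) :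
    ∀ᶠ u in cofinite, ∀ᶠ v in cofinite, T u v := by
  have hT' : DefP L (univ : Set M) fun p : D × D => T p.1 (h₂ p.2 (k p.1 p.2)) :=
    hT.comp (DefF.id.fst.prodMk hdef)
  have h1 : ∀ᶠ y in cofinite, ∀ᶠ u in cofinite, T u (h₂ y (k u y)) := by
    filter_upwards [hk, h] with y hky hy
    refine hD.eventually_of_injOn (P := fun u => T u (h₂ y (k u y)))
      (hT'.comp (DefF.id.prodMk (defF_const_univ y))) (f := h₁ y) hky ?_ ?_
    · intro x hx x' hx' hxx'
      rw [← show k (h₁ y x) y = x from hx, hxx']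
      exact hx'
    · filter_upwards [hky, hy] with x hx hTx
      rwa [hx]
  have h2 := hD.eventually_comm (P := fun y u => T u (h₂ y (k u y)))
    (hT'.comp (DefF.id.snd.prodMk DefF.id.fst)) h1
  filter_upwards [h2, hinj] with u hu ⟨S, hS, hSinj⟩
  exact hD.eventually_of_injOn (hT.fix_univ u) hS hSinj hu

/-- An element algebraic over each of two pairs that are jointly generic over `C` is algebraic
over `C`. -/
theorem StronglyMinimal.mem_acl_of_generic_pairs (hD : StronglyMinimal L M D) {p q : D × D}
    (hgen : ∀ S : (D × D) × (D × D) → Prop, DefP L C S → S (p, q) →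
      ∀ᶠ x₁ in cofinite, ∀ᶠ x₂ in cofinite, ∀ᶠ y₁ in cofinite, ∀ᶠ y₂ in cofinite,
        S ((x₁, x₂), (y₁, y₂)))
    {g : M} (hp : g ∈ acl L (C ∪ range (code L M p))) (hq : g ∈ acl L (C ∪ range (code L M q))) :
    g ∈ acl L C := by
  have := hD.neBot
  obtain ⟨θ, n, hθ, hθp, hθn⟩ := exists_family_of_mem_acl hp
  obtain ⟨ψ, m, hψ, hψq, hψm⟩ := exists_family_of_mem_acl hq
  have hψ₂ : DefP L C fun r : (M × D) × D => ψ ((r.1.2, r.2), r.1.1) :=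
    hψ.comp ((DefF.id.fst.snd.prodMk DefF.id.snd).prodMk DefF.id.fst.fst)
  have hψ₁ : DefP L C fun r : M × D => ∀ᶠ y₂ in cofinite, ψ ((r.2, y₂), r.1) :=
    hD.defP_eventually hψ₂
  -- the elements that are algebraic, by way of `ψ`, over a generic pair
  let G : M → Prop := fun z => ∀ᶠ y₁ in cofinite, ∀ᶠ y₂ in cofinite, ψ ((y₁, y₂), z)
  have hG : DefP L C G := hD.defP_eventually hψ₁
  have hGfin : {z | G z}.Finite := by
    refine finite_of_encard_le_coe (k := m) (not_lt.1 fun hlt => ?_)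
    obtain ⟨f, hf, hfG⟩ := lt_encard_iff_exists_injective.1 hlt
    obtain ⟨y₁, hy₁⟩ := (eventually_all.2 (show ∀ i, ∀ᶠ y₁ in cofinite, ∀ᶠ y₂ in cofinite, ψ ((y₁, y₂), f i)
      from hfG)).exists
    obtain ⟨y₂, hy₂⟩ := (eventually_all.2 hy₁).exists
    exact not_lt.2 (hψm (y₁, y₂)) (lt_encard_iff_exists_injective.2 ⟨f, hf, hy₂⟩)
  by_cases hg : G g
  · exact mem_acl_iff.2 ⟨G, hG, hGfin, hg⟩
  exfalso
  have hS : DefP L C fun r : (D × D) × (D × D) => ∃ z, θ (r.1, z) ∧ ψ (r.2, z) ∧ ¬ G z :=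
    DefP.ex (P := fun (r : (D × D) × (D × D)) z => θ (r.1, z) ∧ ψ (r.2, z) ∧ ¬ G z)
      ((hθ.comp (DefF.id.fst.fst.prodMk DefF.id.snd)).and
        ((hψ.comp (DefF.id.fst.snd.prodMk DefF.id.snd)).and (hG.comp DefF.id.snd).not))
  obtain ⟨x₁, hx₁⟩ := (hgen _ hS ⟨g, hθp, hψq, hg⟩).exists
  obtain ⟨x₂, hx⟩ := hx₁.exists
  have hfin : {z | θ ((x₁, x₂), z)}.Finite := finite_of_encard_le_coe (hθn _)
  have hnot : ∀ z ∈ {z | θ ((x₁, x₂), z)}, ∀ᶠ y₁ in cofinite, ∀ᶠ y₂ in cofinite,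
      ¬ G z → ¬ ψ ((y₁, y₂), z) := by
    intro z _
    by_cases hz : G z
    · exact Eventually.of_forall fun _ => Eventually.of_forall fun _ h => absurd hz h
    · rw [hD.not_eventually ((hψ₁.mono (subset_univ _)).fix_univ z)] at hz
      refine hz.mono fun y₁ hy₁ => ?_
      rw [hD.not_eventually ((hψ₂.mono (subset_univ _)).fix_univ (z, y₁))] at hy₁
      exact hy₁.mono fun _ h _ => h
  obtain ⟨y₁, hy₁, hy₁'⟩ := (hx.and ((eventually_all_finite hfin).2 hnot)).exists
  obtain ⟨y₂, ⟨z, hθz, hψz, hGz⟩, hy₂⟩ :=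
    (hy₁.and ((eventually_all_finite hfin).2 hy₁')).exists
  exact hy₂ z hθz hGz hψz

variable {d : ℕ} {K : DefinableField L (∅ : Set M) d}

theorem injective_sixIndices : ∀ t s r : Fin 3, t ≠ s → t ≠ r → s ≠ r →
    Injective (![(t, 0), (t, 1), (s, 0), (r, 0), (s, 1), (r, 1)] : Fin 6 → Fin 3 × ℕ) := by
  unfold Injective
  decide

/-- Suppose the entries of a twisted array are `h f y x`, where `f` is the parameter in the
direction `t` and `y`, `x` are the parameters in the other two directions. If `h` admits a
triangular change of variables, then the two opposite lines of the unit cube in the direction `t`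
form a generic quadruple. -/
theorem lines_generic_aux (hsm : StronglyMinimal L M K.carrier) {a : Fin 3 → ℕ → K.carrier}
    (ha : AlgIndepOver L C (fun p : Fin 3 × ℕ => (a p.1 p.2 : Fin d → M)))
    {t s r : Fin 3} (hts : t ≠ s) (htr : t ≠ r) (hsr : s ≠ r)
    (h k : K.carrier → K.carrier → K.carrier → K.carrier)
    (hh : DefF L (∅ : Set M) fun p : K.carrier × K.carrier × K.carrier => h p.1 p.2.1 p.2.2)
    (hkd : DefF L (∅ : Set M) fun p : K.carrier × K.carrier × K.carrier => k p.1 p.2.1 p.2.2)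
    (hent : ∀ i, twistedEntry a i = h (a t (i t)) (a s (i s)) (a r (i r)))
    (hk : ∀ f, ∀ᶠ y in cofinite, ∀ᶠ x in cofinite, k f (h f y x) y = x)
    (hinj : ∀ f f', f ≠ f' → ∀ᶠ u in cofinite, ∃ S ∈ (cofinite : Filter K.carrier),
      InjOn (fun y => h f' y (k f u y)) S)
    (S : (K.carrier × K.carrier) × (K.carrier × K.carrier) → Prop) (hS : DefP L C S)
    (hSa : S ((twistedEntry a (update (fun _ => 0) t 0), twistedEntry a (update (fun _ => 0) t 1)),
      (twistedEntry a (update (fun _ => 1) t 0), twistedEntry a (update (fun _ => 1) t 1)))) :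
    ∀ᶠ x₁ in cofinite, ∀ᶠ x₂ in cofinite, ∀ᶠ y₁ in cofinite, ∀ᶠ y₂ in cofinite,
      S ((x₁, x₂), (y₁, y₂)) := by
  have := hsm.infinite
  have hS' := hS.mono (subset_univ _)
  have hh' : ∀ {E : Type w} [DSort L M E] {B : Set M} {f y x : E → K.carrier}, DefF L B f →
      DefF L B y → DefF L B x → DefF L B fun e => h (f e) (y e) (x e) := fun hf hy hx =>
    (hh.mono (empty_subset _)).comp (hf.prodMk (hy.prodMk hx))
  have hk' : ∀ {E : Type w} [DSort L M E] {B : Set M} {f y x : E → K.carrier}, DefF L B f →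
      DefF L B y → DefF L B x → DefF L B fun e => k (f e) (y e) (x e) := fun hf hy hx =>
    (hkd.mono (empty_subset _)).comp (hf.prodMk (hy.prodMk hx))
  let P : (Fin 6 → K.carrier) → Prop := fun x =>
    S ((h (x 0) (x 2) (x 3), h (x 1) (x 2) (x 3)), (h (x 0) (x 4) (x 5), h (x 1) (x 4) (x 5)))
  have hP : DefP L C P := hS.comp
    (((hh' (DefF.id.apply _) (DefF.id.apply _) (DefF.id.apply _)).prodMk
      (hh' (DefF.id.apply _) (DefF.id.apply _) (DefF.id.apply _))).prodMk
    ((hh' (DefF.id.apply _) (DefF.id.apply _) (DefF.id.apply _)).prodMk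
      (hh' (DefF.id.apply _) (DefF.id.apply _) (DefF.id.apply _))))
  let τ : Fin 6 → Fin 3 × ℕ := ![(t, 0), (t, 1), (s, 0), (r, 0), (s, 1), (r, 1)]
  have hτ : Injective τ := injective_sixIndices t s r hts htr hsr
  have hgen : ∀ᶠ x in generic K.carrier 6, P x := by
    refine (ha.comp_injective hτ).eventually_generic (x := fun l => a (τ l).1 (τ l).2) hsm hP ?_
    simp only [hent, update_self, update_of_ne hts.symm, update_of_ne htr.symm] at hSa
    exact hSa
  have hgen' : ∀ᶠ f in cofinite, ∀ᶠ f' in cofinite, ∀ᶠ y in cofinite, ∀ᶠ x in cofinite,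
      ∀ᶠ y' in cofinite, ∀ᶠ x' in cofinite,
        S ((h f y x, h f' y x), (h f y' x', h f' y' x')) := by
    simp only [eventually_generic_succ, eventually_generic_zero] at hgen
    refine hgen.mono fun f hgen => hgen.mono fun f' hgen => hgen.mono fun y hgen =>
      hgen.mono fun x hgen => hgen.mono fun y' hgen => hgen.mono fun x' hgen => ?_
    have hP6 : P ![f, f', y, x, y', x'] := hgen ![]
    simpa only [P, Matrix.cons_val] using hP6
  obtain ⟨f, hgen'⟩ := hgen'.exists
  obtain ⟨f', hgen', hne⟩ := (hgen'.and (eventually_cofinite_ne f)).exists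
  have hdef : DefF L (univ : Set M) fun p : K.carrier × K.carrier => h f' p.2 (k f p.1 p.2) :=
    hh' (defF_const_univ _) DefF.id.snd (hk' (defF_const_univ _) DefF.id.fst DefF.id.snd)
  have hS₂ : DefP L (univ : Set M) fun z : ((K.carrier × K.carrier) × K.carrier) × K.carrier =>
      S (z.1.1, (z.1.2, z.2)) :=
    hS'.comp (DefF.id.fst.fst.prodMk (DefF.id.fst.snd.prodMk DefF.id.snd))
  have hS₁ : DefP L (univ : Set M) fun z : K.carrier × K.carrier =>
      ∀ᶠ y₁ in cofinite, ∀ᶠ y₂ in cofinite, S (z, (y₁, y₂)) :=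
    hsm.defP_eventually (hsm.defP_eventually hS₂)
  refine hsm.eventually_of_triangular
    (T := fun x₁ x₂ => ∀ᶠ y₁ in cofinite, ∀ᶠ y₂ in cofinite, S ((x₁, x₂), (y₁, y₂)))
    (h₁ := h f) (h₂ := h f') hS₁ hdef (hk f) (hinj f f' hne.symm)
    (hgen'.mono fun y hy => hy.mono fun x hx => ?_)
  exact hsm.eventually_of_triangular (T := fun y₁ y₂ => S ((h f y x, h f' y x), (y₁, y₂)))
    (hS'.fix_univ _) hdef (hk f) (hinj f f' hne.symm) hx

/-- Two opposite lines of the unit cube of a twisted array form a generic quadruple. -/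
theorem lines_generic (hsm : StronglyMinimal L M K.carrier) {a : Fin 3 → ℕ → K.carrier}
    (ha : AlgIndepOver L C (fun p : Fin 3 × ℕ => (a p.1 p.2 : Fin d → M))) (t : Fin 3)
    (S : (K.carrier × K.carrier) × (K.carrier × K.carrier) → Prop) (hS : DefP L C S)
    (hSa : S ((twistedEntry a (update (fun _ => 0) t 0), twistedEntry a (update (fun _ => 0) t 1)),
      (twistedEntry a (update (fun _ => 1) t 0), twistedEntry a (update (fun _ => 1) t 1)))) :
    ∀ᶠ x₁ in cofinite, ∀ᶠ x₂ in cofinite, ∀ᶠ y₁ in cofinite, ∀ᶠ y₂ in cofinite,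
      S ((x₁, x₂), (y₁, y₂)) := by
  have d1 : DefF L (∅ : Set M) fun p : K.carrier × K.carrier × K.carrier => p.1 := DefF.id.fst
  have d2 : DefF L (∅ : Set M) fun p : K.carrier × K.carrier × K.carrier => p.2.1 := DefF.id.snd.fst
  have d3 : DefF L (∅ : Set M) fun p : K.carrier × K.carrier × K.carrier => p.2.2 := DefF.id.snd.snd
  have hadd : ∀ c : K.carrier, ∀ᶠ y in cofinite, c + y ≠ 0 := fun c =>
    (eventually_cofinite_ne (-c)).mono fun y hy h => hy (eq_neg_of_add_eq_zero_right h)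
  fin_cases t
  · -- `u = (f + y) / (x + y)`, where `f = a₀`, `y = b₀`, `x = c₀`
    refine lines_generic_aux hsm ha (t := 0) (s := 1) (r := 2) (by decide) (by decide) (by decide)
      (fun f y x => (f + y) / (x + y)) (fun f u y => (f + y) / u - y) ((d1.add d2).div (d3.add d2))
      (((d1.add d3).div d2).sub d3) (fun i => rfl) (fun f => ?_) (fun f f' hf => ?_) S hS hSa
    · filter_upwards [hadd f] with y hy
      refine Eventually.of_forall fun x => ?_
      rw [div_div_cancel₀ hy]
      ring
    · filter_upwards [eventually_cofinite_ne 0] with u hu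
      refine ⟨_, hadd f, fun y hy y' hy' h => ?_⟩
      simp only [sub_add_cancel] at h
      rw [div_div_eq_mul_div, div_div_eq_mul_div, div_eq_div_iff hy hy'] at h
      have h0 : u * ((f - f') * (y - y')) = 0 := by linear_combination h
      simpa [hu, sub_eq_zero, hf] using h0
  · -- `u = (x + f) / (y + f)`, where `f = b₀`, `y = c₀`, `x = a₀`
    refine lines_generic_aux hsm ha (t := 1) (s := 2) (r := 0) (by decide) (by decide) (by decide)
      (fun f y x => (x + f) / (y + f)) (fun f u y => u * (y + f) - f) ((d3.add d1).div (d2.add d1))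
      ((d2.mul (d3.add d1)).sub d1) (fun i => rfl) (fun f => ?_) (fun f f' hf => ?_) S hS hSa
    · filter_upwards [hadd f] with y hy
      refine Eventually.of_forall fun x => ?_
      rw [div_mul_cancel₀ _ (by rwa [add_comm])]
      ring
    · filter_upwards [eventually_cofinite_ne 1] with u hu
      refine ⟨_, hadd f', fun y hy y' hy' h => ?_⟩
      simp only at h
      rw [add_comm y f', add_comm y' f', div_eq_div_iff hy hy'] at h
      have h0 : (u - 1) * ((f' - f) * (y - y')) = 0 := by linear_combination h
      simpa [sub_eq_zero, hu, hf.symm] using h0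
  · -- `u = (x + y) / (f + y)`, where `f = c₀`, `y = b₀`, `x = a₀`
    refine lines_generic_aux hsm ha (t := 2) (s := 1) (r := 0) (by decide) (by decide) (by decide)
      (fun f y x => (x + y) / (f + y)) (fun f u y => u * (f + y) - y) ((d3.add d2).div (d1.add d2))
      ((d2.mul (d1.add d3)).sub d3) (fun i => rfl) (fun f => ?_) (fun f f' hf => ?_) S hS hSa
    · filter_upwards [hadd f] with y hy
      refine Eventually.of_forall fun x => ?_
      rw [div_mul_cancel₀ _ hy]
      ring
    · filter_upwards [eventually_cofinite_ne 0] with u hu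
      refine ⟨_, hadd f', fun y hy y' hy' h => ?_⟩
      simp only [sub_add_cancel] at h
      rw [div_eq_div_iff hy hy'] at h
      have h0 : u * ((f' - f) * (y - y')) = 0 := by linear_combination h
      simpa [hu, sub_eq_zero, hf.symm] using h0

/-- An element that is algebraic over each of two opposite lines of the unit cube is algebraic. -/
theorem mem_acl_of_lines (hsm : StronglyMinimal L M K.carrier) {a : Fin 3 → ℕ → K.carrier}
    (ha : AlgIndepOver L C (fun p : Fin 3 × ℕ => (a p.1 p.2 : Fin d → M))) (t : Fin 3) {g : M}
    (h : ∀ n ≤ 1, g ∈ acl L (C ∪ (range (twistedArray L K a (update (fun _ => n) t 0)) ∪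
      range (twistedArray L K a (update (fun _ => n) t 1))))) : g ∈ acl L C := by
  have hr : ∀ x y : K.carrier, range (code L M (x, y)) = range (x : Fin d → M) ∪
      range (y : Fin d → M) := fun x y => Sum.elim_range _ _
  have h0 := h 0 zero_le_one
  have h1 := h 1 le_rfl
  exact hsm.mem_acl_of_generic_pairs (lines_generic hsm ha t)
    (by rw [hr]; exact h0) (by rw [hr]; exact h1)

/-- The base of each frame consists of algebraic elements, since it is contained in the algebraic
closures of two opposite lines. -/
theorem hasMaxRank_frameBase (hsm : StronglyMinimal L M K.carrier) {a : Fin 3 → ℕ → K.carrier}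
    (ha : AlgIndepOver L (∅ : Set M) (fun p : Fin 3 × ℕ => (a p.1 p.2 : Fin d → M))) (t : Fin 3) :
    HasMaxRank L (frameBase L (twistedArray L K a) t) 0 := by
  have hbase : frameBase L (twistedArray L K a) t ⊆ acl L ∅ := by
    intro g hg
    refine mem_acl_of_lines hsm ha t fun n hn => ?_
    rw [empty_union]
    exact mem_iInter₂.1 hg (fun _ => n) fun _ => Nat.lt_succ_of_le hn
  have hrank : ∀ g ∈ acl L (∅ : Set M), HasTupleRank L (fun _ : Fin 1 => g) 0 := by
    rintro g ⟨s, hs, hf, hg⟩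
    refine ⟨⟨_, hs, hg, morleyRankGE_zero.2 ⟨fun _ => g, hg⟩, fun h => ?_⟩,
      fun X _ hgX => morleyRankGE_zero.2 ⟨_, hgX⟩⟩
    rw [show Order.succ (0 : Ordinal.{0}) = 1 by simp] at h
    refine h.infinite (hf.preimage (f := fun x : Fin 1 → M => x 0) fun x _ y _ hxy => ?_)
    exact funext fun i => by rw [Subsingleton.elim i 0]; exact hxy
  refine ⟨?_, fun g hg => ⟨0, le_rfl, hrank g (acl_subset_of_subset_acl hbase hg)⟩⟩
  -- the coordinates of `0` are algebraic, and there are some since `0 ≠ 1`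
  have hd : Nonempty (Fin d) := by
    by_contra hd
    rw [not_nonempty_iff] at hd
    exact zero_ne_one (α := K.carrier) (Subtype.ext (Subsingleton.elim _ _))
  have h0 : range ((0 : K.carrier) : Fin d → M) ⊆ acl L ∅ :=
    DefP.range_code_subset_acl (P := fun x : K.carrier => x = 0)
      (DefP.eq DefF.id DefinableField.defF_zero) (finite_singleton 0) rfl
  have h0' := h0 ⟨hd.some, rfl⟩
  exact ⟨_, acl_mono (empty_subset _) h0', hrank _ h0'⟩

end Lines

/-! ### The twisted array has neither the group form nor the field form -/

section Forms

variable {L : FirstOrder.Language.{u, v}} {M : Type w} [L.Structure M]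
variable {C : Set M} {d : ℕ} {K : DefinableField L (∅ : Set M) d}

theorem range_code_tuple {e : ℕ} (z : Fin e → M) : range (code L M z) = range z := by
  ext m
  constructor
  · rintro ⟨⟨i, _⟩, rfl⟩
    exact ⟨i, rfl⟩
  · rintro ⟨i, rfl⟩
    exact ⟨(i, (0 : Fin 1)), rfl⟩

/-- A definable ternary relation on `Mᵉ`, as a definable predicate on triples. -/
theorem defP_of_definable_triples {e : ℕ} {R : Set (Fin 3 × Fin e → M)} (hR : C.Definable L R) :
    DefP L C fun x : Fin 3 → Fin e → M => (fun q => x q.1 q.2) ∈ R :=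
  Definable.defP (E := Fin 3 → Fin e → M)
    (hR.preimage_comp fun q : Fin 3 × Fin e => (q.1, (q.2, (0 : Fin 1))))

/-- The two entries on the line through the origin of the array in the direction `t` form a generic
pair over `C`, so the second is not algebraic over the first. -/
theorem twistedArray_line_not_algebraic (hsm : StronglyMinimal L M K.carrier)
    {a : Fin 3 → ℕ → K.carrier}
    (ha : AlgIndepOver L C (fun p : Fin 3 × ℕ => (a p.1 p.2 : Fin d → M))) (t : Fin 3) :
    ¬ range (twistedArray L K a (update (fun _ => 0) t 1)) ⊆
      acl L (C ∪ range (twistedArray L K a (update (fun _ => 0) t 0))) := by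
  intro h
  have := hsm.neBot
  have := hsm.infinite
  have h' : range (code L M (twistedEntry a (update (fun _ => 0) t 1))) ⊆
    acl L (C ∪ range (code L M (twistedEntry a (update (fun _ => 0) t 0)))) := h
  obtain ⟨S, hS, hSa, hf⟩ := exists_family_of_range_subset_acl h'
  obtain ⟨x₁, hx₁⟩ := (lines_generic hsm ha t (fun p => S p.1) (hS.comp DefF.id.fst) hSa).exists
  have hx₁' : ∀ᶠ x₂ in cofinite, S (x₁, x₂) := hx₁.mono fun x₂ h => by
    obtain ⟨_, h⟩ := h.exists
    exact h.exists.choose_spec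
  obtain ⟨x₂, h₂, h₂'⟩ := (hx₁'.and (hf x₁).compl_mem_cofinite).exists
  exact h₂' h₂

/-- The entries of the unit cube of a twisted array are not interalgebraic over `C` with tuples
`w i` such that a single tuple `z` is a quotient, for a `C`-definable operation `R`, of the two
entries of each of two opposite lines: `z` would be algebraic over `C`. -/
theorem no_common_quotient (hsm : StronglyMinimal L M K.carrier) {a : Fin 3 → ℕ → K.carrier}
    (ha : AlgIndepOver L C (fun p : Fin 3 × ℕ => (a p.1 p.2 : Fin d → M))) (t : Fin 3) {e : ℕ}
    {w : (Fin 3 → ℕ) → Fin e → M} (hw : ∀ i, InteralgOver L C (twistedArray L K a i) (w i))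
    {R : Set (Fin 3 × Fin e → M)} (hR : C.Definable L R) {z : Fin e → M}
    (hz : ∀ i, (fun q => (![w (update i t 0), z, w (update i t 1)] : Fin 3 → Fin e → M) q.1 q.2) ∈ R)
    (hquot : ∀ i z', (fun q =>
      (![w (update i t 0), z', w (update i t 1)] : Fin 3 → Fin e → M) q.1 q.2) ∈ R → z' = z)
    (hprod : ∀ i y, (fun q =>
      (![w (update i t 0), z, y] : Fin 3 → Fin e → M) q.1 q.2) ∈ R → y = w (update i t 1)) :
    False := by
  let f := twistedArray L K a
  have hRP := defP_of_definable_triples hR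
  have hvec : ∀ {E : Type w} [DSort L M E] {B : Set M} {x y z : E → Fin e → M}, DefF L B x →
      DefF L B y → DefF L B z → DefF L B fun v => (![x v, y v, z v] : Fin 3 → Fin e → M) := by
    intro E _ B x y z hx hy hz
    refine DefF.pi fun i => ?_
    fin_cases i
    · exact hx
    · exact hy
    · exact hz
  have hfw : ∀ i, range (f i) ⊆ acl L (C ∪ range (w i)) := fun i => by
    rw [← hw i]
    exact subset_union_right.trans subset_acl
  have hwf : ∀ i, range (w i) ⊆ acl L (C ∪ range (f i)) := fun i => by
    rw [hw i]
    exact subset_union_right.trans subset_acl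
  -- `z` is definable over the two entries of a line
  have hzline : ∀ i, range z ⊆ acl L (C ∪ (range (f (update i t 0)) ∪
      range (f (update i t 1)))) := by
    intro i
    have h1 : range (code L M z) ⊆
        acl L (C ∪ (range (w (update i t 0)) ∪ range (w (update i t 1)))) := by
      refine DefP.range_code_subset_acl
        (P := fun z' => (fun q : Fin 3 × Fin e => (![w (update i t 0), z', w (update i t 1)] :
          Fin 3 → Fin e → M) q.1 q.2) ∈ R)
        ((hRP.mono subset_union_left).comp
          (hvec (DefF.const _ ?_) DefF.id (DefF.const _ ?_)))
        ((finite_singleton z).subset fun z' hz' => hquot i z' hz') (hz i)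
      · rw [range_code_tuple]
        exact subset_union_left.trans subset_union_right
      · rw [range_code_tuple]
        exact subset_union_right.trans subset_union_right
    rw [range_code_tuple] at h1
    refine h1.trans (acl_subset_of_subset_acl (union_subset ?_ (union_subset ?_ ?_)))
    · exact subset_union_left.trans subset_acl
    · exact (hwf _).trans (acl_mono (union_subset_union_right _ subset_union_left))
    · exact (hwf _).trans (acl_mono (union_subset_union_right _ subset_union_right))
  have hzC : range z ⊆ acl L C := fun g hg =>
    mem_acl_of_lines hsm ha t fun n _ => hzline (fun _ => n) hg
  -- hence the second entry of a line is algebraic over the first one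
  have hwline : range (w (update (fun _ => 0) t 1)) ⊆
      acl L (C ∪ range (f (update (fun _ => 0) t 0))) := by
    have h1 : range (code L M (w (update (fun _ => 0) t 1))) ⊆
        acl L (C ∪ (range (w (update (fun _ => 0) t 0)) ∪ range z)) := by
      refine DefP.range_code_subset_acl
        (P := fun y => (fun q : Fin 3 × Fin e => (![w (update (fun _ => 0) t 0), z, y] :
          Fin 3 → Fin e → M) q.1 q.2) ∈ R)
        ((hRP.mono subset_union_left).comp
          (hvec (DefF.const _ ?_) (DefF.const _ ?_) DefF.id))
        ((finite_singleton _).subset fun y hy => hprod _ y hy) (hz _)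
      · rw [range_code_tuple]
        exact subset_union_left.trans subset_union_right
      · rw [range_code_tuple]
        exact subset_union_right.trans subset_union_right
    rw [range_code_tuple] at h1
    refine h1.trans (acl_subset_of_subset_acl (union_subset ?_ (union_subset ?_ ?_)))
    · exact subset_union_left.trans subset_acl
    · exact hwf _
    · exact hzC.trans (acl_mono subset_union_left)
  refine twistedArray_line_not_algebraic hsm ha t ((hfw _).trans (acl_subset_of_subset_acl ?_))
  exact union_subset (subset_union_left.trans subset_acl) hwline

/-- In the group form, the quotient `c₀⁻¹ c₁` is common to all lines in the third direction. -/
theorem not_hasGroupForm_twistedArray (hsm : StronglyMinimal L M K.carrier)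
    {a : Fin 3 → ℕ → K.carrier}
    (ha : AlgIndepOver L C (fun p : Fin 3 × ℕ => (a p.1 p.2 : Fin d → M))) :
    ¬ HasGroupForm L C (twistedArray L K a) := by
  rintro ⟨e, G, x, y, z, -, hw⟩
  refine no_common_quotient hsm ha 2
    (w := fun i => (x (i 0) * y (i 1) * z (i 2) : G.carrier).1) hw G.definable_mul
    (z := ((z 0)⁻¹ * z 1 : G.carrier).1) (fun i => ?_) (fun i z' => ?_) fun i v => ?_
  · refine ⟨_, (z 0)⁻¹ * z 1, rfl, rfl, congrArg Subtype.val ?_⟩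
    simp [mul_assoc]
  · rintro ⟨g, h, h0, h1, h2⟩
    have h0' := Subtype.ext h0
    have h2' := Subtype.ext h2
    simp only [update_self, ne_eq, Fin.reduceEq, not_false_eq_true, update_of_ne] at h0' h2'
    rw [← h0', mul_assoc, mul_assoc, mul_assoc] at h2'
    rw [show z' = (h : Fin e → M) from h1]
    refine congrArg Subtype.val ?_
    rw [mul_left_cancel (mul_left_cancel h2'), inv_mul_cancel_left]
  · rintro ⟨g, h, h0, h1, h2⟩
    rw [show v = ((g * h : G.carrier) : Fin e → M) from h2, ← Subtype.ext h0, ← Subtype.ext h1]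
    refine congrArg Subtype.val ?_
    simp [mul_assoc]

/-- In the field form, the quotient of the first two values of the multiplicative parameter is
common to all lines in its direction. -/
theorem not_hasFieldForm_twistedArray (hsm : StronglyMinimal L M K.carrier)
    {a : Fin 3 → ℕ → K.carrier}
    (ha : AlgIndepOver L C (fun p : Fin 3 × ℕ => (a p.1 p.2 : Fin d → M))) :
    ¬ HasFieldForm L C (twistedArray L K a) := by
  rintro ⟨e, F, x, σ, hw⟩
  let w : (Fin 3 → ℕ) → F.carrier := fun i =>
    x (σ 0) (i (σ 0)) * (x (σ 1) (i (σ 1)) + x (σ 2) (i (σ 2)))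
  have hw0 : ∀ i, w i ≠ 0 := by
    intro i hi
    -- otherwise the entry would be algebraic, as `0` is definable by `z + z = z`
    have hzero : range (code L M ((0 : F.carrier) : Fin e → M)) ⊆ acl L C := by
      refine DefP.range_code_subset_acl (P := fun z : Fin e → M =>
        (fun q : Fin 3 × Fin e => (fun _ => z : Fin 3 → Fin e → M) q.1 q.2) ∈ _)
        ((defP_of_definable_triples F.definable_add).comp (DefF.pi fun _ => DefF.id))
        ((finite_singleton ((0 : F.carrier) : Fin e → M)).subset ?_)
        ⟨0, 0, rfl, rfl, by rw [add_zero]⟩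
      rintro z ⟨p, q, h0, h1, h2⟩
      have hpq : p = q := Subtype.ext (h0.symm.trans h1)
      have hp : p = p + q := Subtype.ext (h0.symm.trans h2)
      subst hpq
      have hp0 : p = 0 := left_eq_add.1 hp
      rw [mem_singleton_iff, ← hp0]
      exact h0
    rw [range_code_tuple] at hzero
    have hfC : range (twistedArray L K a i) ⊆ acl L C := by
      have h1 : range (twistedArray L K a i) ⊆ acl L (C ∪ range (w i : Fin e → M)) := by
        rw [← show acl L (C ∪ range (twistedArray L K a i)) = _ from hw i]
        exact subset_union_right.trans subset_acl
      rw [hi] at h1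
      exact h1.trans (acl_subset_of_subset_acl (union_subset subset_acl hzero))
    choose P hP hf hx using fun k => mem_acl_iff.1 (hfC ⟨k, rfl⟩)
    have hcoord : ∀ k, DefF L C fun y : K.carrier => code L M y k := fun k => DefF.id.code_apply k
    refine twistedEntry_not_algebraic ha i (P := fun y => ∀ k, P k (code L M y k))
      (DefP.forall_finite fun k => (hP k).comp (hcoord k)) ?_ hx
    exact Finite.preimage Subtype.val_injective.injOn (Finite.pi' (t := fun k => {m | P k m}) hf)
  have h01 : (0 : Fin 3) ≠ 1 := by decide
  have h02 : (0 : Fin 3) ≠ 2 := by decide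
  have hσ1 : σ 1 ≠ σ 0 := fun h => h01 (σ.injective h).symm
  have hσ2 : σ 2 ≠ σ 0 := fun h => h02 (σ.injective h).symm
  have hupd : ∀ i n, w (update i (σ 0) n) =
      x (σ 0) n * (x (σ 1) (i (σ 1)) + x (σ 2) (i (σ 2))) := fun i n => by
    simp only [w, update_self, update_of_ne hσ1, update_of_ne hσ2]
  have hx0 : x (σ 0) 0 ≠ 0 := by
    have := hw0 (update (fun _ => 0) (σ 0) 0)
    rw [hupd] at this
    exact left_ne_zero_of_mul this
  have hratio : ∀ i, w (update i (σ 0) 0) * (x (σ 0) 1 / x (σ 0) 0) = w (update i (σ 0) 1) := by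
    intro i
    rw [hupd, hupd]
    field_simp
  refine no_common_quotient hsm ha (σ 0) (w := fun i => (w i : Fin e → M)) hw F.definable_mul
    (z := (x (σ 0) 1 / x (σ 0) 0 : F.carrier).1) (fun i => ?_) (fun i z' => ?_) fun i v => ?_
  · exact ⟨_, _, rfl, rfl, congrArg Subtype.val (hratio i).symm⟩
  · rintro ⟨g, h, h0, h1, h2⟩
    have h0' : w (update i (σ 0) 0) = g := Subtype.ext h0
    have h2' : w (update i (σ 0) 1) = g * h := Subtype.ext h2
    rw [← hratio i, ← h0'] at h2'
    exact (show z' = (h : Fin e → M) from h1).trans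
      (congrArg Subtype.val (mul_left_cancel₀ (hw0 _) h2').symm)
  · rintro ⟨g, h, h0, h1, h2⟩
    have h0' : w (update i (σ 0) 0) = g := Subtype.ext h0
    have h1' : x (σ 0) 1 / x (σ 0) 0 = h := Subtype.ext h1
    rw [show v = ((g * h : F.carrier) : Fin e → M) from h2, ← h0', ← h1', hratio]

theorem HasGroupForm.shift {a : Fin 3 → ℕ → K.carrier} (N : ℕ)
    (h : HasGroupForm L C (twistedArray L K a)) :
    HasGroupForm L C (twistedArray L K fun t n => a t (n + N)) := by
  obtain ⟨e, G, x, y, z, hG, hw⟩ := h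
  exact ⟨e, G, fun n => x (n + N), fun n => y (n + N), fun n => z (n + N), hG,
    fun i => hw fun t => i t + N⟩

theorem HasFieldForm.shift {a : Fin 3 → ℕ → K.carrier} (N : ℕ)
    (h : HasFieldForm L C (twistedArray L K a)) :
    HasFieldForm L C (twistedArray L K fun t n => a t (n + N)) := by
  obtain ⟨e, F, x, σ, hw⟩ := h
  exact ⟨e, F, fun t n => x t (n + N), σ, fun i => hw fun t => i t + N⟩

end Forms

end IndiscernibleArrays

theorem mainTheorem2 (L : FirstOrder.Language.{u, v}) (M : Type w) [L.Structure M]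
    (hsat : IndiscernibleArrays.OmegaSaturated L M)
    (d : ℕ) (K : IndiscernibleArrays.DefinableField L (∅ : Set M) d)
    (hrank : IndiscernibleArrays.HasMorleyRank L K.carrier 1)
    (hclosed : IsAlgClosed K.carrier)
    (a : Fin 3 → ℕ → K.carrier)
    (ha : IndiscernibleArrays.AlgIndepOver L (∅ : Set M)
      (fun p : Fin 3 × ℕ => (a p.1 p.2 : Fin d → M))) :
    IndiscernibleArrays.IsIndiscernibleArray L (IndiscernibleArrays.twistedArray L K a) ∧
    IndiscernibleArrays.HasRankSumSubTwo L (IndiscernibleArrays.twistedArray L K a) ∧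
    (∀ t : Fin 3, IndiscernibleArrays.HasMaxRank L
      (IndiscernibleArrays.frameBase L (IndiscernibleArrays.twistedArray L K a) t) 0) ∧
    (¬ IndiscernibleArrays.HasGroupForm L ∅ (IndiscernibleArrays.twistedArray L K a) ∧
      ¬ IndiscernibleArrays.HasFieldForm L ∅ (IndiscernibleArrays.twistedArray L K a)) ∧
    (∀ (C : Set M) (N : ℕ),
      IndiscernibleArrays.AlgIndepOver L C
        (fun p : Fin 3 × ℕ => (a p.1 (p.2 + N) : Fin d → M)) →
      ¬ IndiscernibleArrays.HasGroupForm L C (IndiscernibleArrays.twistedArray L K a) ∧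
        ¬ IndiscernibleArrays.HasFieldForm L C (IndiscernibleArrays.twistedArray L K a)) ∧
    ¬ IndiscernibleArrays.HrushovskiZilberPositive L M := by
  have hsm := IndiscernibleArrays.DefinableField.stronglyMinimal hsat hrank
  have h1 := IndiscernibleArrays.isIndiscernibleArray_twistedArray hsm hrank ha
  have h2 := IndiscernibleArrays.hasRankSumSubTwo_twistedArray hsm ha
  have hG := IndiscernibleArrays.not_hasGroupForm_twistedArray hsm ha
  have hF := IndiscernibleArrays.not_hasFieldForm_twistedArray hsm ha
  refine ⟨h1, h2, IndiscernibleArrays.hasMaxRank_frameBase hsm ha, ⟨hG, hF⟩,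
    fun C N haN => ⟨fun h => ?_, fun h => ?_⟩, fun h => (h d _ h1 h2).elim hG hF⟩
  · exact IndiscernibleArrays.not_hasGroupForm_twistedArray hsm haN (h.shift N)
  · exact IndiscernibleArrays.not_hasFieldForm_twistedArray hsm haN (h.shift N)
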